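/- Let $d\ge 2$. For a Lebesgue measurable set $E\subset\mathbb{R}^d$ let $|E|$ be its Lebesgue measure and $$P(E)=\sup\Big\{\int_E \operatorname{div}T\,dx:\ T\in C^1_c(\mathbb{R}^d;\mathbb{R}^d),\ |T|\le 1\Big\}\in[0,+\infty]$$ its perimeter. For $\alpha>0$ and a Borel set $A\subset\mathbb{R}^d$ let $$I_\alpha(A)=\inf\Big\{\int_{\mathbb{R}^d}\int_{\mathbb{R}^d}\frac{d\mu(x)\,d\mu(y)}{|x-y|^{\alpha}}:\ \mu \text{ a nonnegative Borel measure on } \mathbb{R}^d,\ \mu(A)=1\Big\}\in[0,+\infty]$$ be its Riesz potential energy. For $Q>0$ and an open set $E\subset\mathbb{R}^d$ with topological boundary $\partial E$ put $$\mathcal{F}_{\alpha,Q}(E)=P(E)+Q^2I_\alpha(E),\qquad \mathcal{G}_{\alpha,Q}(E)=P(E)+Q^2I_\alpha(\partial E).$$ **Theorem.** Let $\Omega\subset\mathbb{R}^d$ be compact with smooth boundary (that is, near each point of $\partial\Omega$ the set $\Omega$ is a sublevel set $\{\varphi\le 0\}$ of a $C^\infty$ function $\varphi$ whose differential does not vanish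 at that point), and let $0<m<|\Omega|$. Let $E_0$ be a solution of the constrained isoperimetric problem $$\min\{P(E):\ E\subset\Omega \text{ Lebesgue measurable},\ |E|=m\}.$$ Then, for every $\alpha\in(0,d-1)$ and every $Q>0$, $$\inf_{\substack{E\subset\Omega\ \text{open}\\ |E|=m}}\mathcal{F}_{\alpha,Q}(E)=\inf_{\substack{E\subset\Omega\ \text{open}\\ |E|=m}}\mathcal{G}_{\alpha,Q}(E)=P(E_0)+Q^2I_\alpha(\Omega).$$ -/

import Mathlib

open MeasureTheory Set
open scoped ENNReal ContDiff

noncomputable section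

namespace ChargedDroplet

/-- The Euclidean space `ℝ^d`. -/
abbrev Space (d : ℕ) : Type := EuclideanSpace ℝ (Fin d)

/-- The divergence `∑ i, ∂_i T_i` of a vector field on `ℝ^d`. -/
def divergence {d : ℕ} (T : Space d → Space d) (x : Space d) : ℝ :=
  ∑ i : Fin d, (fderiv ℝ T x (EuclideanSpace.single i 1)) i

/-- The (De Giorgi) perimeter of `E`, i.e. the total variation of its indicator function:
the supremum of `∫_E div T` over `T ∈ C¹_c(ℝ^d; ℝ^d)` with `|T| ≤ 1`. As `T = 0` is admissible,
the truncation of negative values by `ENNReal.ofReal` does not affect the supremum. -/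
def perimeter {d : ℕ} (E : Set (Space d)) : ℝ≥0∞ :=
  ⨆ T ∈ {T : Space d → Space d | ContDiff ℝ 1 T ∧ HasCompactSupport T ∧ ∀ x, ‖T x‖ ≤ 1},
    ENNReal.ofReal (∫ x in E, divergence T x)

/-- The interaction energy `∬ |x - y|^{-α} dμ(x) dν(y)` of two Borel measures.
For `α > 0` the kernel is `+∞` on the diagonal. -/
def rieszInteraction {d : ℕ} (α : ℝ) (μ ν : Measure (Space d)) : ℝ≥0∞ :=
  ∫⁻ x, ∫⁻ y, edist x y ^ (-α) ∂ν ∂μ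

/-- The Riesz potential energy `I_α(A)` of a set: the infimum of the energies `I_α(μ, μ)` over
the Borel measures `μ` with `μ(A) = 1`. -/
def rieszEnergy {d : ℕ} (α : ℝ) (A : Set (Space d)) : ℝ≥0∞ :=
  ⨅ μ ∈ {μ : Measure (Space d) | μ A = 1}, rieszInteraction α μ μ

/-- `F_{α,Q}(E) = P(E) + Q² I_α(E)`. -/
def functionalF {d : ℕ} (α Q : ℝ) (E : Set (Space d)) : ℝ≥0∞ :=
  perimeter E + ENNReal.ofReal (Q ^ 2) * rieszEnergy α E

/-- `G_{α,Q}(E) = P(E) + Q² I_α(∂E)`, where `∂E` is the topological boundary. -/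
def functionalG {d : ℕ} (α Q : ℝ) (E : Set (Space d)) : ℝ≥0∞ :=
  perimeter E + ENNReal.ofReal (Q ^ 2) * rieszEnergy α (frontier E)

/-- `Ω` has smooth boundary: around each boundary point, `Ω` is the sublevel set `{φ ≤ 0}` of a
smooth function whose differential does not vanish at that point (so that `∂Ω` is a smooth
hypersurface and `Ω` lies locally on one side of it). -/
def HasSmoothBoundary {d : ℕ} (Ω : Set (Space d)) : Prop :=
  ∀ x ∈ frontier Ω, ∃ (U : Set (Space d)) (φ : Space d → ℝ),
    IsOpen U ∧ x ∈ U ∧ ContDiffOn ℝ ∞ φ U ∧ fderiv ℝ φ x ≠ 0 ∧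
      Ω ∩ U = {y ∈ U | φ y ≤ 0}

/-- The class of the constrained isoperimetric problem: Lebesgue measurable subsets of `Ω` of
volume `m`. -/
def isoperimetricClass {d : ℕ} (Ω : Set (Space d)) (m : ℝ) : Set (Set (Space d)) :=
  {E | NullMeasurableSet E volume ∧ E ⊆ Ω ∧ volume E = ENNReal.ofReal m}

/-- `E₀` solves the constrained isoperimetric problem `min {P(E) : E ⊆ Ω, |E| = m}`. -/
def IsIsoperimetricSolution {d : ℕ} (Ω : Set (Space d)) (m : ℝ) (E₀ : Set (Space d)) : Prop :=
  E₀ ∈ isoperimetricClass Ω m ∧ ∀ E ∈ isoperimetricClass Ω m, perimeter E₀ ≤ perimeter E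

/-- The class over which `F` and `G` are minimized: open subsets of `Ω` of volume `m`. -/
def openClass {d : ℕ} (Ω : Set (Space d)) (m : ℝ) : Set (Set (Space d)) :=
  {E | IsOpen E ∧ E ⊆ Ω ∧ volume E = ENNReal.ofReal m}

end ChargedDroplet

end

namespace ChargedDroplet

open Filter Topology
open scoped NNReal

variable {d : ℕ}

/-! The lower bounds hold term by term: the perimeter is at least that of the minimiser, and since
`E` and `∂E` lie in the closed set `Ω`, monotonicity of the Riesz energy (`rieszEnergy_mono`) bounds
the other term below by that of `Ω`.

The upper bounds say that a charge nearly optimal for `Ω` can be placed on a set of negligible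
perimeter and volume; this is where `α < d - 1` enters. A nearly optimal probability measure is
pushed into the interior of `Ω` and sampled at `N ≈ r ^ (-p)` points with `α < p < d - 1`, and the
charge is spread uniformly over the balls of radius `r` around them. The total perimeter, of order
`N * r ^ (d - 1)`, and the total self-energy, of order `N⁻¹ * r ^ (-α)`, both vanish with `r`, while
for a good sample the mutual energy is close to that of the measure
(`HasSmoothBoundary.exists_charged_balls`).

These balls are glued to an open set close to `E₀` in perimeter and volume
(`HasSmoothBoundary.exists_open_approx`); adding a small ball near one point and removing one near
another restores the volume exactly (`HasSmoothBoundary.exists_competitor`). For `F` the whole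
charged balls belong to the competitor. For `G` the competitor meets them only in a dense open
subset of tiny volume and perimeter (`exists_dense_open_small`), so that almost all of the charge
sits on the topological boundary.

The approximation inside `Ω` uses the smooth boundary through homeomorphisms close to the identity
that move `Ω` into its interior (`HasSmoothBoundary.exists_homeomorph`), combined with mollification
and the coarea inequality. -/

theorem nontrivial_space (hd : 1 ≤ d) : Nontrivial (Space d) :=
  Module.nontrivial_of_finrank_pos (R := ℝ) (by rwa [finrank_euclideanSpace_fin])

/-! ### Test fields, integration by parts and lower semicontinuity of the perimeter. -/

/-- The vector fields admissible in the definition of the perimeter. -/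
def IsTestField (T : Space d → Space d) : Prop :=
  ContDiff ℝ 1 T ∧ HasCompactSupport T ∧ ∀ x, ‖T x‖ ≤ 1

theorem perimeter_le_iff {E : Set (Space d)} {M : ℝ≥0∞} :
    perimeter E ≤ M ↔ ∀ T : Space d → Space d, IsTestField T →
      ENNReal.ofReal (∫ x in E, divergence T x) ≤ M := by
  simp only [perimeter, iSup_le_iff, mem_ofPred_eq, IsTestField]

theorem IsTestField.ofReal_le_perimeter {T : Space d → Space d} (hT : IsTestField T)
    (E : Set (Space d)) : ENNReal.ofReal (∫ x in E, divergence T x) ≤ perimeter E :=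
  perimeter_le_iff.1 le_rfl T hT

theorem perimeter_congr {E F : Set (Space d)} (h : E =ᵐ[volume] F) :
    perimeter E = perimeter F := by
  simp only [perimeter, setIntegral_congr_set h]

theorem perimeter_empty : perimeter (∅ : Set (Space d)) = 0 := by
  simp [perimeter]

theorem IsTestField.hasCompactSupport_coord {T : Space d → Space d} (hT : IsTestField T)
    (i : Fin d) : HasCompactSupport (fun x => T x i) :=
  hT.2.1.comp_left (g := fun v : Space d => v i) rfl

theorem IsTestField.contDiff_coord {T : Space d → Space d} (hT : IsTestField T)
    (i : Fin d) : ContDiff ℝ 1 (fun x => T x i) :=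
  (EuclideanSpace.proj (𝕜 := ℝ) i).contDiff.comp hT.1

theorem IsTestField.divergence_eq {T : Space d → Space d} (hT : IsTestField T) (x : Space d) :
    divergence T x = ∑ i, fderiv ℝ (fun y => T y i) x (EuclideanSpace.single i 1) := by
  unfold divergence
  refine Finset.sum_congr rfl fun i _ => ?_
  have h : HasFDerivAt (fun y => T y i)
      ((EuclideanSpace.proj (𝕜 := ℝ) i).comp (fderiv ℝ T x)) x :=
    (EuclideanSpace.proj (𝕜 := ℝ) i).hasFDerivAt.comp x
      ((hT.1.differentiable one_ne_zero x).hasFDerivAt)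
  rw [h.fderiv]
  rfl

theorem IsTestField.continuous_divergence {T : Space d → Space d} (hT : IsTestField T) :
    Continuous (divergence T) := by
  have : divergence T = fun x =>
      ∑ i, fderiv ℝ (fun y => T y i) x (EuclideanSpace.single i 1) := funext hT.divergence_eq
  rw [this]
  exact continuous_finsetSum _ fun i _ =>
    ((hT.contDiff_coord i).continuous_fderiv one_ne_zero).clm_apply continuous_const

theorem IsTestField.hasCompactSupport_divergence {T : Space d → Space d} (hT : IsTestField T) :
    HasCompactSupport (divergence T) := by
  refine HasCompactSupport.intro hT.2.1 fun x hx => ?_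
  have h := (image_eq_zero_of_notMem_tsupport
    (fun h => hx (tsupport_fderiv_subset ℝ h)) : fderiv ℝ T x = 0)
  simp [divergence, h]

theorem IsTestField.integrable_divergence {T : Space d → Space d} (hT : IsTestField T) :
    Integrable (divergence T) :=
  hT.continuous_divergence.integrable_of_hasCompactSupport hT.hasCompactSupport_divergence

/-- Integration by parts against a Lipschitz function. -/
theorem IsTestField.integral_mul_divergence {T : Space d → Space d} (hT : IsTestField T)
    {f : Space d → ℝ} {C : ℝ≥0} (hf : LipschitzWith C f) :
    ∫ x, f x * divergence T x = - ∫ x, fderiv ℝ f x (T x) := by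
  have hlip : ∀ i, ∃ D, LipschitzWith D (fun x => T x i) := fun i =>
    ContDiff.lipschitzWith_of_hasCompactSupport (hT.hasCompactSupport_coord i)
      (hT.contDiff_coord i) one_ne_zero
  have hd : ∀ i x v, lineDeriv ℝ (fun y => T y i) x v = fderiv ℝ (fun y => T y i) x v :=
    fun i x v => ((hT.contDiff_coord i).differentiable one_ne_zero x).lineDeriv_eq_fderiv
  have hparts : ∀ i : Fin d,
      ∫ x, f x * fderiv ℝ (fun y => T y i) x (EuclideanSpace.single i 1)
        = - ∫ x, lineDeriv ℝ f x (EuclideanSpace.single i 1) * T x i := by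
    intro i
    obtain ⟨D, hD⟩ := hlip i
    rw [hf.integral_lineDeriv_mul_eq hD (hT.hasCompactSupport_coord i), ← integral_neg]
    refine integral_congr_ae (Eventually.of_forall fun x => ?_)
    simp only [hd, map_neg]
    ring
  have hint1 : ∀ i : Fin d, Integrable
      (fun x => f x * fderiv ℝ (fun y => T y i) x (EuclideanSpace.single i 1)) := by
    intro i
    refine Continuous.integrable_of_hasCompactSupport ?_ ?_
    · exact hf.continuous.mul
        (((hT.contDiff_coord i).continuous_fderiv one_ne_zero).clm_apply continuous_const)
    · exact (((hT.hasCompactSupport_coord i).fderiv ℝ).comp_left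
        (g := fun L : Space d →L[ℝ] ℝ => L (EuclideanSpace.single i 1)) rfl).mul_left
  have hint2 : ∀ i : Fin d, Integrable
      (fun x => lineDeriv ℝ f x (EuclideanSpace.single i 1) * T x i) := by
    intro i
    refine Integrable.mul_of_top_right ?_ (hf.memLp_lineDeriv _)
    exact (hT.contDiff_coord i).continuous.integrable_of_hasCompactSupport
      (hT.hasCompactSupport_coord i)
  simp only [hT.divergence_eq, Finset.mul_sum]
  rw [integral_finsetSum _ fun i _ => hint1 i]
  simp only [hparts]
  rw [Finset.sum_neg_distrib, ← integral_finsetSum _ fun i _ => hint2 i]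
  congr 1
  refine integral_congr_ae ?_
  -- By Rademacher, directional derivatives come from the Fréchet derivative almost everywhere.
  filter_upwards [hf.ae_differentiableAt] with x hx
  simp only [hx.lineDeriv_eq_fderiv]
  have hTx : T x = ∑ i, T x i • EuclideanSpace.single i (1 : ℝ) := by
    ext j
    simp [Finset.sum_apply, Pi.single_apply]
  conv_rhs => rw [hTx, map_sum]
  simp [mul_comm]

theorem IsTestField.ofReal_integral_mul_divergence_le {T : Space d → Space d}
    (hT : IsTestField T) {f : Space d → ℝ} {C : ℝ≥0} (hf : LipschitzWith C f) :
    ENNReal.ofReal (∫ x, f x * divergence T x) ≤ ∫⁻ x, ‖fderiv ℝ f x‖ₑ := by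
  rw [hT.integral_mul_divergence hf, ← integral_neg]
  refine (Real.ofReal_le_enorm _).trans ((enorm_integral_le_lintegral_enorm _).trans ?_)
  refine lintegral_mono fun x => ?_
  simp only [enorm_neg]
  refine (ContinuousLinearMap.le_opENorm _ _).trans ?_
  have : ‖T x‖ₑ ≤ 1 := by
    rw [← ofReal_norm]; exact ENNReal.ofReal_le_one.2 (hT.2.2 x)
  calc ‖fderiv ℝ f x‖ₑ * ‖T x‖ₑ ≤ ‖fderiv ℝ f x‖ₑ * 1 := by gcongr
    _ = _ := mul_one _

/-- Lower semicontinuity of the perimeter along bounded sequences of Lipschitz functions. -/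
theorem perimeter_le_liminf {E : Set (Space d)} (hE : MeasurableSet E)
    {f : ℕ → Space d → ℝ} (hlip : ∀ n, ∃ C, LipschitzWith C (f n))
    (hb : ∀ n x, |f n x| ≤ 1)
    (hlim : ∀ᵐ x, Tendsto (fun n => f n x) atTop (𝓝 (E.indicator 1 x))) :
    perimeter E ≤ liminf (fun n => ∫⁻ x, ‖fderiv ℝ (f n) x‖ₑ) atTop := by
  refine perimeter_le_iff.2 fun T hT => ?_
  have hconv : Tendsto (fun n => ∫ x, f n x * divergence T x) atTop
      (𝓝 (∫ x in E, divergence T x)) := by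
    have heq : ∫ x in E, divergence T x = ∫ x, E.indicator 1 x * divergence T x := by
      rw [← integral_indicator hE]
      refine integral_congr_ae (Eventually.of_forall fun x => ?_)
      by_cases hx : x ∈ E <;> simp [hx]
    rw [heq]
    refine tendsto_integral_of_dominated_convergence (fun x => |divergence T x|) ?_
      hT.integrable_divergence.abs ?_ ?_
    · intro n
      obtain ⟨C, hC⟩ := hlip n
      exact (hC.continuous.mul hT.continuous_divergence).aestronglyMeasurable
    · intro n
      refine Eventually.of_forall fun x => ?_
      rw [norm_mul, Real.norm_eq_abs, Real.norm_eq_abs]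
      exact mul_le_of_le_one_left (abs_nonneg _) (hb n x)
    · filter_upwards [hlim] with x hx
      exact hx.mul_const _
  have hconv' := (ENNReal.continuous_ofReal.tendsto _).comp hconv
  rw [← hconv'.liminf_eq]
  refine liminf_le_liminf (Eventually.of_forall fun n => ?_)
  obtain ⟨C, hC⟩ := hlip n
  exact hT.ofReal_integral_mul_divergence_le hC

theorem perimeter_le_of_tendsto {E : Set (Space d)} (hE : MeasurableSet E)
    {f : ℕ → Space d → ℝ} (hlip : ∀ n, ∃ C, LipschitzWith C (f n))
    (hb : ∀ n x, |f n x| ≤ 1)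
    (hlim : ∀ᵐ x, Tendsto (fun n => f n x) atTop (𝓝 (E.indicator 1 x)))
    {M : ℝ≥0∞} (hM : ∀ᶠ n in atTop, ∫⁻ x, ‖fderiv ℝ (f n) x‖ₑ ≤ M) :
    perimeter E ≤ M :=
  (perimeter_le_liminf hE hlip hb hlim).trans <|
    (liminf_le_liminf hM).trans (by simp)

/-! ### Ramp functions, the perimeter of balls and the coarea inequality. -/

/-- The piecewise linear function that vanishes below `t` and equals `1` above `t + 1 / c`. -/
def ramp (c t s : ℝ) : ℝ := max 0 (min 1 (c * (s - t)))

theorem ramp_nonneg (c t s : ℝ) : 0 ≤ ramp c t s := le_max_left _ _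

theorem ramp_le_one (c t s : ℝ) : ramp c t s ≤ 1 :=
  max_le zero_le_one (min_le_left _ _)

theorem ramp_eq_zero {c t s : ℝ} (hc : 0 ≤ c) (h : s ≤ t) : ramp c t s = 0 :=
  max_eq_left ((min_le_right _ _).trans (mul_nonpos_of_nonneg_of_nonpos hc (by linarith)))

theorem ramp_eq_one {c t s : ℝ} (h : 1 ≤ c * (s - t)) : ramp c t s = 1 := by
  rw [ramp, min_eq_left h, max_eq_right zero_le_one]

theorem ramp_eq_mul {c t s : ℝ} (h0 : 0 ≤ c * (s - t)) (h1 : c * (s - t) ≤ 1) :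
    ramp c t s = c * (s - t) := by
  rw [ramp, min_eq_right h1, max_eq_right h0]

theorem lipschitzWith_ramp (c : ℝ≥0) (t : ℝ) : LipschitzWith c (ramp c t) := by
  have h : LipschitzWith c (fun s : ℝ => (c : ℝ) * (s - t)) := by
    refine LipschitzWith.of_dist_le_mul fun x y => ?_
    rw [Real.dist_eq, Real.dist_eq, ← mul_sub, abs_mul, NNReal.abs_eq]
    simp
  exact ((h.const_min 1).const_max 0)

theorem tendsto_ramp (t s : ℝ) :
    Tendsto (fun n : ℕ => ramp n t s) atTop (𝓝 (if t < s then 1 else 0)) := by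
  split_ifs with h
  · obtain ⟨N, hN⟩ := exists_nat_gt (1 / (s - t))
    refine tendsto_const_nhds.congr' ?_
    filter_upwards [eventually_ge_atTop N] with n hn
    refine (ramp_eq_one ?_).symm
    have h' : 0 < s - t := by linarith
    rw [div_lt_iff₀ h'] at hN
    have : (N : ℝ) ≤ n := by exact_mod_cast hn
    nlinarith
  · refine tendsto_const_nhds.congr fun n => ?_
    exact (ramp_eq_zero (Nat.cast_nonneg n) (not_lt.1 h)).symm

/-- Off the transition region the composition with a ramp has zero derivative, as it attains
an extremum there. -/
theorem fderiv_ramp_comp_eq_zero {c : ℝ} (hc : 0 < c) {t : ℝ} {w : Space d → ℝ} {x : Space d}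
    (h : w x ∉ Ioo t (t + 1 / c)) : fderiv ℝ (fun y => ramp c t (w y)) x = 0 := by
  by_cases h1 : w x ≤ t
  · refine IsLocalMin.fderiv_eq_zero (Eventually.of_forall fun y => ?_)
    simp only [ramp_eq_zero hc.le h1]
    exact ramp_nonneg _ _ _
  · refine IsLocalMax.fderiv_eq_zero (Eventually.of_forall fun y => ?_)
    have h2 : t + 1 / c ≤ w x := by
      by_contra h2
      exact h ⟨not_le.1 h1, not_le.1 h2⟩
    have h3 : 1 ≤ c * (w x - t) := by
      have : 1 / c ≤ w x - t := by linarith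
      rw [div_le_iff₀ hc] at this
      linarith
    simp only [ramp_eq_one h3]
    exact ramp_le_one _ _ _

/-- The indicator is the limit of ramps of slope `n` in the distance to the sphere. Their gradient
is at most `n` and lives on an annulus of width `1 / n`, so the total variation is at most `n * (r ^
d - (r - 1 / n) ^ d)` times the volume of the unit ball. -/
theorem perimeter_ball_le (x : Space d) {r : ℝ} (hr : 0 < r) :
    perimeter (Metric.ball x r)
      ≤ ENNReal.ofReal (d * r ^ (d - 1)) * volume (Metric.ball (0 : Space d) 1) := by
  let w : Space d → ℝ := fun y => r - dist y x
  have hwlip : LipschitzWith 1 w := by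
    refine LipschitzWith.of_dist_le_mul fun y z => ?_
    simp only [w, Real.dist_eq, NNReal.coe_one, one_mul]
    have := abs_dist_sub_le z y x
    rwa [show r - dist y x - (r - dist z x) = dist z x - dist y x by ring, dist_comm y z]
  have hlip : ∀ n : ℕ, LipschitzWith n (fun y => ramp n 0 (w y)) := fun n => by
    simpa [Function.comp_def] using (lipschitzWith_ramp n 0).comp hwlip
  refine perimeter_le_of_tendsto (f := fun n y => ramp n 0 (w y)) measurableSet_ball
    (fun n => ⟨n, hlip n⟩) (fun n y => ?_) (Eventually.of_forall fun y => ?_) ?_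
  · rw [abs_of_nonneg (ramp_nonneg _ _ _)]
    exact ramp_le_one _ _ _
  · convert tendsto_ramp 0 (w y) using 2
    by_cases hy : dist y x < r
    · simp [w, hy]
    · simp [w, hy]
  · obtain ⟨N, hN⟩ := exists_nat_gt (1 / r)
    filter_upwards [eventually_ge_atTop N] with n hn
    have hnr : 1 / r < n := hN.trans_le (by exact_mod_cast hn)
    have hn0 : (0 : ℝ) < n := (by positivity : 0 < 1 / r).trans hnr
    have hnr' : 1 / (n : ℝ) < r := by
      rw [div_lt_iff₀ hn0]; rw [div_lt_iff₀ hr] at hnr; linarith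
    let S := Metric.ball x r \ Metric.closedBall x (r - 1 / n)
    have hbound : ∀ y, ‖fderiv ℝ (fun y => ramp n 0 (w y)) y‖ₑ
        ≤ S.indicator (fun _ => (n : ℝ≥0∞)) y := by
      intro y
      by_cases hy : y ∈ S
      · rw [indicator_of_mem hy, ← ofReal_norm]
        refine ENNReal.ofReal_le_of_le_toReal ?_
        simpa using norm_fderiv_le_of_lipschitz ℝ (hlip n) (x₀ := y)
      · rw [fderiv_ramp_comp_eq_zero hn0]
        · rw [← ofReal_norm, norm_zero, ENNReal.ofReal_zero]
          exact zero_le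
        · intro h
          apply hy
          simp only [w, mem_Ioo, zero_add] at h
          simp only [S, Set.mem_sdiff, Metric.mem_ball, Metric.mem_closedBall, not_le]
          constructor <;> linarith [h.1, h.2]
    refine (lintegral_mono hbound).trans ?_
    rw [lintegral_indicator_const (measurableSet_ball.diff measurableSet_closedBall)]
    have hsub : Metric.closedBall x (r - 1 / n) ⊆ Metric.ball x r :=
      Metric.closedBall_subset_ball (by have : 0 < 1 / (n : ℝ) := by positivity
                                        linarith)
    have h0 : 0 ≤ r - 1 / n := by linarith
    have hvol : volume S = ENNReal.ofReal (r ^ d - (r - 1 / n) ^ d)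
        * volume (Metric.ball (0 : Space d) 1) := by
      rw [measure_sdiff hsub measurableSet_closedBall.nullMeasurableSet
        measure_closedBall_lt_top.ne, Measure.addHaar_ball_of_pos _ _ hr,
        Measure.addHaar_closedBall _ _ h0, finrank_euclideanSpace_fin,
        ENNReal.ofReal_sub _ (by positivity), ENNReal.sub_mul]
      intros; exact measure_ball_lt_top.ne
    rw [hvol, ← mul_assoc]
    gcongr
    rw [← ENNReal.ofReal_natCast, ← ENNReal.ofReal_mul hn0.le]
    refine ENNReal.ofReal_le_ofReal ?_
    have hb := abs_pow_sub_pow_le r (r - 1 / n) d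
    rw [abs_of_nonneg hr.le, abs_of_nonneg h0,
      max_eq_left (by have : 0 < 1 / (n : ℝ) := by positivity
                      linarith), sub_sub_cancel, abs_of_nonneg (a := 1 / (n : ℝ)) (by positivity)]
      at hb
    calc (n : ℝ) * (r ^ d - (r - 1 / n) ^ d) ≤ n * (1 / n * d * r ^ (d - 1)) := by
          gcongr; exact (le_abs_self _).trans hb
      _ = d * r ^ (d - 1) := by field_simp

theorem enorm_fderiv_ramp_comp {c : ℝ} (hc : 0 < c) {t : ℝ} {w : Space d → ℝ}
    (hw : Differentiable ℝ w) (x : Space d) :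
    ‖fderiv ℝ (fun y => ramp c t (w y)) x‖ₑ
      = {y | t < w y ∧ w y < t + 1 / c}.indicator
          (fun y => ENNReal.ofReal c * ‖fderiv ℝ w y‖ₑ) x := by
  by_cases hx : t < w x ∧ w x < t + 1 / c
  · rw [indicator_of_mem (by exact hx)]
    have hev : (fun y => ramp c t (w y)) =ᶠ[𝓝 x] fun y => c * (w y - t) := by
      have h1 := hw.continuous.continuousAt.eventually (Ioo_mem_nhds hx.1 hx.2)
      filter_upwards [h1] with y hy
      refine ramp_eq_mul (mul_nonneg hc.le (by linarith [hy.1])) ?_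
      have : w y - t ≤ 1 / c := by linarith [hy.2]
      rw [le_div_iff₀ hc] at this
      linarith
    have hder : HasFDerivAt (fun y => c * (w y - t)) (c • fderiv ℝ w x) x :=
      ((hw x).hasFDerivAt.sub_const t).const_mul c
    rw [hev.fderiv_eq, hder.fderiv, enorm_smul, Real.enorm_eq_ofReal hc.le]
  · rw [indicator_of_notMem (by exact hx), fderiv_ramp_comp_eq_zero hc (by exact hx),
      ← ofReal_norm, norm_zero, ENNReal.ofReal_zero]

/-- The inequality in the coarea formula, in the form of the existence of a good superlevel
set. -/
theorem exists_perimeter_superlevel_le {w : Space d → ℝ} {C : ℝ≥0} (hlip : LipschitzWith C w)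
    (hw : Differentiable ℝ w) {a b : ℝ} (hab : a < b) :
    ∃ τ ∈ Ioo a b, ENNReal.ofReal (b - a) * perimeter {x | τ < w x}
      ≤ ∫⁻ x, ‖fderiv ℝ w x‖ₑ := by
  let g : ℕ → ℝ → ℝ≥0∞ := fun n t =>
    ∫⁻ x, ‖fderiv ℝ (fun y => ramp (n + 1 : ℕ) t (w y)) x‖ₑ
  let k : ℕ → ℝ → Space d → ℝ≥0∞ := fun n t x =>
    {p : ℝ × Space d | p.1 < w p.2 ∧ w p.2 < p.1 + 1 / ((n + 1 : ℕ) : ℝ)}.indicator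
      (fun p => ENNReal.ofReal ((n + 1 : ℕ) : ℝ) * ‖fderiv ℝ w p.2‖ₑ) (t, x)
  have hk : ∀ n, Measurable (Function.uncurry (k n)) := by
    intro n
    refine Measurable.indicator ?_ ?_
    · exact ((measurable_fderiv ℝ w).comp measurable_snd).enorm.const_mul _
    · have h1 : Measurable fun p : ℝ × Space d => w p.2 := hlip.continuous.measurable.comp
        measurable_snd
      exact (measurableSet_lt measurable_fst h1).inter
        (measurableSet_lt h1 (measurable_fst.add_const _))
  have hgk : ∀ n t, g n t = ∫⁻ x, k n t x := by
    intro n t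
    refine lintegral_congr fun x => ?_
    rw [enorm_fderiv_ramp_comp (by positivity) hw]
    rfl
  have hgm : ∀ n, Measurable (g n) := by
    intro n
    rw [funext (hgk n)]
    exact (hk n).lintegral_prod_right
  have hgint : ∀ n, ∫⁻ t, g n t = ∫⁻ x, ‖fderiv ℝ w x‖ₑ := by
    intro n
    simp only [hgk]
    rw [lintegral_lintegral_swap (hk n).aemeasurable]
    refine lintegral_congr fun x => ?_
    -- For fixed `x` the levels that contribute form an interval of length `1 / (n + 1)`, which
    -- cancels the slope `n + 1` of the ramp.
    have : (fun t => k n t x) = (Ioo (w x - 1 / ((n + 1 : ℕ) : ℝ)) (w x)).indicator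
        fun _ => ENNReal.ofReal ((n + 1 : ℕ) : ℝ) * ‖fderiv ℝ w x‖ₑ := by
      ext t
      simp only [k, indicator_apply, mem_ofPred_eq, mem_Ioo]
      refine if_congr ?_ rfl rfl
      constructor <;> rintro ⟨h1, h2⟩ <;> constructor <;> linarith
    rw [this, lintegral_indicator_const measurableSet_Ioo, Real.volume_Ioo, sub_sub_cancel,
      mul_right_comm, ← ENNReal.ofReal_mul (by positivity)]
    rw [mul_one_div_cancel (by positivity), ENNReal.ofReal_one, one_mul]
  let G : ℝ → ℝ≥0∞ := fun t => liminf (fun n => g n t) atTop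
  have hG : ∀ t, perimeter {x | t < w x} ≤ G t := by
    intro t
    refine perimeter_le_liminf (f := fun n y => ramp (n + 1 : ℕ) t (w y))
      (measurableSet_lt measurable_const hlip.continuous.measurable) (fun n => ?_)
      (fun n y => ?_) (Eventually.of_forall fun x => ?_)
    · refine ⟨(n + 1 : ℕ) * C, ?_⟩
      have := (lipschitzWith_ramp (n + 1 : ℕ) t).comp hlip
      simpa [Function.comp_def] using this
    · rw [abs_of_nonneg (ramp_nonneg _ _ _)]
      exact ramp_le_one _ _ _
    · convert (tendsto_ramp t (w x)).comp (tendsto_add_atTop_nat 1) using 2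
      · simp
      · simp only [indicator_apply, mem_ofPred_eq, Pi.one_apply]
  have hvol : volume (Ioo a b) = ENNReal.ofReal (b - a) := Real.volume_Ioo
  have hpos : ENNReal.ofReal (b - a) ≠ 0 := by simpa using hab
  -- Some level does no worse than the average over `(a, b)`; Fatou then bounds the integral of `G`.
  obtain ⟨τ, hτ, hle⟩ := exists_le_setLAverage (μ := volume) (s := Ioo a b) (f := G)
    (by rw [hvol]; exact hpos) (by rw [hvol]; exact ENNReal.ofReal_ne_top)
    (Measurable.liminf hgm).aemeasurable
  refine ⟨τ, hτ, ?_⟩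
  calc ENNReal.ofReal (b - a) * perimeter {x | τ < w x}
      ≤ ENNReal.ofReal (b - a) * ⨍⁻ t in Ioo a b, G t ∂volume := by
        gcongr; exact (hG τ).trans hle
    _ = ∫⁻ t in Ioo a b, G t := by
        rw [setLAverage_eq, hvol, ENNReal.mul_div_cancel hpos ENNReal.ofReal_ne_top]
    _ ≤ ∫⁻ t, G t := setLIntegral_le_lintegral _ _
    _ ≤ liminf (fun n => ∫⁻ t, g n t) atTop := lintegral_liminf_le hgm
    _ = ∫⁻ x, ‖fderiv ℝ w x‖ₑ := by simp [hgint]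

/-! ### Duality for smooth functions and mollification of sets. -/

/-- The total variation of a smooth function is bounded by duality with test fields. -/
theorem lintegral_enorm_fderiv_le {u : Space d → ℝ} (hu : ContDiff ℝ 2 u)
    (hc : HasCompactSupport u) {M : ℝ≥0∞}
    (hM : ∀ T : Space d → Space d, IsTestField T →
      ENNReal.ofReal (∫ x, u x * divergence T x) ≤ M) :
    ∫⁻ x, ‖fderiv ℝ u x‖ₑ ≤ M := by
  obtain ⟨C, hlip⟩ := ContDiff.lipschitzWith_of_hasCompactSupport hc hu two_ne_zero
  have hdu : ContDiff ℝ 1 (fderiv ℝ u) := hu.fderiv_right (by norm_num)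
  let G : Space d → Space d := fun x =>
    WithLp.toLp 2 fun i => fderiv ℝ u x (EuclideanSpace.single i 1)
  have hG1 : ContDiff ℝ 1 G := by
    rw [contDiff_euclidean]
    intro i
    exact hdu.clm_apply contDiff_const
  have hGv : ∀ x v, fderiv ℝ u x v = inner ℝ (G x) v := by
    intro x v
    have hv : v = ∑ i, v i • EuclideanSpace.single i (1 : ℝ) := by
      ext j
      simp [Finset.sum_apply, Pi.single_apply]
    conv_lhs => rw [hv, map_sum]
    simp [PiLp.inner_apply, G]
  have hGc : HasCompactSupport G := by
    refine HasCompactSupport.intro hc fun x hx => ?_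
    have h := (image_eq_zero_of_notMem_tsupport
      (fun h => hx (tsupport_fderiv_subset ℝ h)) : fderiv ℝ u x = 0)
    ext i
    simp [G, h]
  have hle : ∀ x, ‖fderiv ℝ u x‖ ≤ ‖G x‖ := fun x =>
    ContinuousLinearMap.opNorm_le_bound _ (norm_nonneg _) fun v => by
      rw [hGv]; exact norm_inner_le_norm _ _
  have hGint : Integrable fun x => ‖G x‖ :=
    hG1.continuous.norm.integrable_of_hasCompactSupport hGc.norm
  have hmain : ∀ δ > 0, ENNReal.ofReal (∫ x, ‖G x‖)
      ≤ M + ENNReal.ofReal (δ * volume.real (tsupport G)) := by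
    intro δ hδ
    -- The optimal field `-G / |G|` is singular at zeros of `G`. Replacing `|G|` by `q` gives an
    -- admissible field and loses at most `δ` pointwise on the support of `G`.
    let q : Space d → ℝ := fun x => √(‖G x‖ ^ 2 + δ ^ 2)
    have hq : ∀ x, 0 < q x := fun x => Real.sqrt_pos.2 (by positivity)
    have hGq : ∀ x, ‖G x‖ ≤ q x := fun x => Real.le_sqrt_of_sq_le (by nlinarith [sq_nonneg δ])
    have hqG : ∀ x, q x ≤ ‖G x‖ + δ := fun x => by
      refine Real.sqrt_le_iff.2 ⟨by positivity, ?_⟩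
      nlinarith [norm_nonneg (G x)]
    let T : Space d → Space d := fun x => -((q x)⁻¹ • G x)
    have hT : IsTestField T := by
      refine ⟨?_, ?_, fun x => ?_⟩
      · refine (ContDiff.smul (ContDiff.inv ?_ fun x => (hq x).ne') hG1).neg
        exact ((hG1.norm_sq ℝ).add contDiff_const).sqrt fun x => by positivity
      · exact hGc.mono fun x hx => by
          simp only [T, Function.mem_support] at hx ⊢
          rintro h
          simp [h] at hx
      · simp only [T, norm_neg, norm_smul, norm_inv, Real.norm_eq_abs, abs_of_pos (hq x)]
        rw [inv_mul_le_iff₀ (hq x), mul_one]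
        exact hGq x
    have h1 := hM T hT
    rw [hT.integral_mul_divergence hlip] at h1
    have h2 : ∀ x, fderiv ℝ u x (T x) = - ((q x)⁻¹ * ‖G x‖ ^ 2) := by
      intro x
      simp only [T, hGv, inner_neg_right, inner_smul_right, real_inner_self_eq_norm_sq]
    simp only [h2, integral_neg, neg_neg] at h1
    have h3 : ∀ x, ‖G x‖ ≤ (q x)⁻¹ * ‖G x‖ ^ 2 + (tsupport G).indicator (fun _ => δ) x := by
      intro x
      by_cases hx : x ∈ tsupport G
      · rw [indicator_of_mem hx, ← sub_le_iff_le_add, inv_mul_eq_div, le_div_iff₀ (hq x)]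
        nlinarith [hqG x, hGq x, norm_nonneg (G x), hq x]
      · simp [image_eq_zero_of_notMem_tsupport hx, indicator_of_notMem hx]
    have hqc : Continuous q :=
      Real.continuous_sqrt.comp ((hG1.continuous.norm.pow 2).add continuous_const)
    have i1 : Integrable fun x => (q x)⁻¹ * ‖G x‖ ^ 2 := by
      refine Continuous.integrable_of_hasCompactSupport ?_ ?_
      · exact (hqc.inv₀ fun x => (hq x).ne').mul (hG1.continuous.norm.pow 2)
      · exact HasCompactSupport.mul_left (hGc.comp_left (g := fun v => ‖v‖ ^ 2) (by simp))
    have i2 : Integrable ((tsupport G).indicator fun _ : Space d => δ) :=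
      (integrable_indicator_iff (isClosed_tsupport G).measurableSet).2
        (integrableOn_const hGc.measure_lt_top.ne)
    have h4 : ∫ x, ‖G x‖ ≤ (∫ x, (q x)⁻¹ * ‖G x‖ ^ 2) + δ * volume.real (tsupport G) := by
      refine (integral_mono hGint (i1.add i2) h3).trans (le_of_eq ?_)
      rw [integral_add' i1 i2, integral_indicator_const _ (isClosed_tsupport G).measurableSet,
        smul_eq_mul, mul_comm δ]
    refine (ENNReal.ofReal_le_ofReal h4).trans (ENNReal.ofReal_add_le.trans ?_)
    gcongr
  have hlim : ENNReal.ofReal (∫ x, ‖G x‖) ≤ M := by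
    have ht : Tendsto (fun δ : ℝ => M + ENNReal.ofReal (δ * volume.real (tsupport G)))
        (𝓝[>] 0) (𝓝 (M + ENNReal.ofReal (0 * volume.real (tsupport G)))) := by
      refine tendsto_const_nhds.add ((ENNReal.continuous_ofReal.tendsto _).comp ?_)
      exact (tendsto_nhdsWithin_of_tendsto_nhds tendsto_id).mul_const _
    simp only [zero_mul, ENNReal.ofReal_zero, add_zero] at ht
    exact ge_of_tendsto ht (by filter_upwards [self_mem_nhdsWithin] with δ hδ using hmain δ hδ)
  refine le_trans ?_ hlim
  rw [ofReal_integral_eq_lintegral_ofReal hGint (Eventually.of_forall fun x => norm_nonneg _)]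
  refine lintegral_mono fun x => ?_
  rw [← ofReal_norm]
  exact ENNReal.ofReal_le_ofReal (hle x)

theorem divergence_comp_add_right (T : Space d → Space d) (z x : Space d) :
    divergence (fun y => T (y + z)) x = divergence T (x + z) := by
  simp only [divergence, fderiv_comp_add_right]

theorem IsTestField.comp_add_right {T : Space d → Space d} (hT : IsTestField T) (z : Space d) :
    IsTestField (fun y => T (y + z)) :=
  ⟨hT.1.comp (contDiff_id.add contDiff_const),
    hT.2.1.comp_homeomorph (Homeomorph.addRight z), fun _ => hT.2.2 _⟩

/-- Averaging the translates of a set against a probability density does not increase the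
variation. -/
theorem IsTestField.ofReal_integral_average_mul_divergence_le {T : Space d → Space d}
    (hT : IsTestField T) {E : Set (Space d)} (hE : MeasurableSet E) {ρ : Space d → ℝ}
    (hρc : Continuous ρ) (hρi : Integrable ρ) (hρ0 : ∀ z, 0 ≤ ρ z) (hρ1 : ∫ z, ρ z = 1) :
    ENNReal.ofReal (∫ x, (∫ z, ρ z * E.indicator 1 (x - z)) * divergence T x)
      ≤ perimeter E := by
  by_cases htop : perimeter E = ⊤
  · simp [htop]
  let F : Space d → Space d → ℝ := fun x z => ρ z * E.indicator 1 (x - z) * divergence T x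
  have hFint : Integrable (Function.uncurry F) (volume.prod volume) := by
    refine ((hT.integrable_divergence.abs).mul_prod hρi).mono' ?_ (Eventually.of_forall ?_)
    · refine AEStronglyMeasurable.mul (AEStronglyMeasurable.mul ?_ ?_) ?_
      · exact (hρc.comp continuous_snd).aestronglyMeasurable
      · have : Measurable fun p : Space d × Space d => E.indicator (1 : Space d → ℝ) (p.1 - p.2) :=
          (measurable_one.indicator hE).comp (measurable_fst.sub measurable_snd)
        exact this.aestronglyMeasurable
      · exact (hT.continuous_divergence.comp continuous_fst).aestronglyMeasurable
    · rintro ⟨x, z⟩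
      simp only [Function.uncurry, F, norm_mul, Real.norm_eq_abs, abs_of_nonneg (hρ0 z)]
      have h1 : |E.indicator (1 : Space d → ℝ) (x - z)| ≤ 1 := by
        by_cases h : x - z ∈ E <;> simp [h]
      nlinarith [hρ0 z, abs_nonneg (divergence T x), mul_nonneg (hρ0 z)
        (abs_nonneg (divergence T x))]
  -- Fubini and the change of variables `x ↦ x + z` move the translation from the set to the test
  -- field, which stays admissible.
  have hswap : ∫ x, (∫ z, ρ z * E.indicator 1 (x - z)) * divergence T x
      = ∫ z, ρ z * ∫ x in E, divergence (fun y => T (y + z)) x := by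
    calc ∫ x, (∫ z, ρ z * E.indicator 1 (x - z)) * divergence T x
        = ∫ x, ∫ z, F x z := by simp only [F, integral_mul_const]
      _ = ∫ z, ∫ x, F x z := integral_integral_swap hFint
      _ = _ := by
        refine integral_congr_ae (Eventually.of_forall fun z => ?_)
        simp only [F, mul_assoc]
        rw [integral_const_mul, ← integral_add_right_eq_self _ z, ← integral_indicator hE]
        congr 1
        refine integral_congr_ae (Eventually.of_forall fun x => ?_)
        simp only [add_sub_cancel_right]
        by_cases hx : x ∈ E <;> simp [hx, divergence_comp_add_right]
  have hswapint : Integrable fun z => ρ z * ∫ x in E, divergence (fun y => T (y + z)) x := by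
    have := hFint.integral_prod_right
    refine this.congr (Eventually.of_forall fun z => ?_)
    simp only [Function.uncurry, F, mul_assoc]
    rw [integral_const_mul, ← integral_add_right_eq_self _ z, ← integral_indicator hE]
    congr 1
    refine integral_congr_ae (Eventually.of_forall fun x => ?_)
    simp only [add_sub_cancel_right]
    by_cases hx : x ∈ E <;> simp [hx, divergence_comp_add_right]
  rw [hswap]
  refine ENNReal.ofReal_le_of_le_toReal ?_
  calc ∫ z, ρ z * ∫ x in E, divergence (fun y => T (y + z)) x
      ≤ ∫ z, ρ z * (perimeter E).toReal := by
        refine integral_mono hswapint (hρi.mul_const _) fun z => ?_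
        refine mul_le_mul_of_nonneg_left ?_ (hρ0 z)
        exact (ENNReal.ofReal_le_iff_le_toReal htop).1
          ((hT.comp_add_right z).ofReal_le_perimeter E)
    _ = (perimeter E).toReal := by rw [integral_mul_const, hρ1, one_mul]

/-- Bounded sets are approximated by smooth functions whose total variation does not exceed the
perimeter. -/
theorem exists_smooth_approx {E : Set (Space d)} (hE : MeasurableSet E)
    (hb : Bornology.IsBounded E) :
    ∃ u : ℕ → Space d → ℝ, (∀ n, ContDiff ℝ ∞ (u n)) ∧ (∀ n, HasCompactSupport (u n)) ∧
      (∀ n x, u n x ∈ Icc 0 1) ∧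
      (∀ n : ℕ, Function.support (u n) ⊆ Metric.thickening (2 / (n + 1)) E) ∧
      (∀ᵐ x, Tendsto (fun n => u n x) atTop (𝓝 (E.indicator 1 x))) ∧
      ∀ n, ∫⁻ x, ‖fderiv ℝ (u n) x‖ₑ ≤ perimeter E := by
  -- The bounded ratio of outer to inner radius is what Lebesgue differentiation needs for
  -- convergence almost everywhere.
  let φ : ℕ → ContDiffBump (0 : Space d) := fun n =>
    ⟨1 / (n + 1), 2 / (n + 1), by positivity, by gcongr; norm_num⟩
  let ρ : ℕ → Space d → ℝ := fun n => (φ n).normed volume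
  let χ : Space d → ℝ := E.indicator 1
  have hχ : ∀ x, χ x ∈ Icc 0 1 := fun x => by
    by_cases h : x ∈ E <;> simp [χ, h]
  have hχm : Measurable χ := measurable_one.indicator hE
  have hEfin : volume E ≠ ⊤ := hb.measure_lt_top.ne
  have hχint : Integrable χ := (integrable_indicator_iff hE).2 (integrableOn_const hEfin)
  let u : ℕ → Space d → ℝ := fun n x => ∫ z, ρ n z * χ (x - z)
  have hconv : ∀ n, u n = convolution (ρ n) χ (ContinuousLinearMap.lsmul ℝ ℝ) volume := by
    intro n; ext x; rfl
  have hρ0 : ∀ n z, 0 ≤ ρ n z := fun n z => (φ n).nonneg_normed z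
  have hρ1 : ∀ n, ∫ z, ρ n z = 1 := fun n => (φ n).integral_normed
  have hρi : ∀ n, Integrable (ρ n) := fun n => (φ n).integrable_normed
  have hsmooth : ∀ n, ContDiff ℝ ∞ (u n) := by
    intro n
    rw [hconv]
    exact (φ n).hasCompactSupport_normed.contDiff_convolution_left _ (φ n).contDiff_normed
      hχint.locallyIntegrable
  have hsupp : ∀ n : ℕ, Function.support (u n) ⊆ Metric.thickening (2 / (n + 1)) E := by
    intro n x hx
    by_contra hne
    apply hx
    simp only [u]
    rw [integral_eq_zero_of_ae (Eventually.of_forall fun z => ?_)]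
    simp only [Pi.zero_apply, mul_eq_zero]
    by_cases hz : z ∈ Metric.ball (0 : Space d) (2 / (n + 1))
    · right
      refine indicator_of_notMem (fun hmem => hne ?_) _
      refine Metric.mem_thickening_iff.2 ⟨x - z, hmem, ?_⟩
      simpa [dist_eq_norm] using hz
    · left
      rw [← Function.notMem_support]
      simpa only [ρ, (φ n).support_normed_eq] using hz
  have hcs : ∀ n, HasCompactSupport (u n) := fun n =>
    HasCompactSupport.of_support_subset_isCompact
      (hb.thickening (δ := 2 / (n + 1))).isCompact_closure ((hsupp n).trans subset_closure)
  refine ⟨u, hsmooth, hcs, fun n x => ⟨?_, ?_⟩, hsupp, ?_, fun n => ?_⟩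
  · exact integral_nonneg fun z => mul_nonneg (hρ0 n z) (hχ _).1
  · calc u n x ≤ ∫ z, ρ n z := by
          refine integral_mono_of_nonneg (Eventually.of_forall fun z =>
            mul_nonneg (hρ0 n z) (hχ _).1) (hρi n) (Eventually.of_forall fun z => ?_)
          exact mul_le_of_le_one_right (hρ0 n z) (hχ _).2
      _ = 1 := hρ1 n
  · have h := ContDiffBump.ae_convolution_tendsto_right_of_locallyIntegrable (φ := φ)
      (l := atTop) (K := 2) (μ := volume) (g := χ) ?_ ?_ hχint.locallyIntegrable
    · filter_upwards [h] with x hx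
      simpa only [hconv] using hx
    · have : Tendsto (fun n : ℕ => 2 * (1 / ((n : ℝ) + 1))) atTop (𝓝 (2 * 0)) :=
        tendsto_one_div_add_atTop_nhds_zero_nat.const_mul 2
      simpa [φ, div_eq_mul_inv] using this
    · refine Eventually.of_forall fun n => ?_
      simp [φ, div_eq_mul_inv]
  · refine lintegral_enorm_fderiv_le (contDiff_infty.1 (hsmooth n) 2) (hcs n)
      fun T hT => ?_
    exact hT.ofReal_integral_average_mul_divergence_le hE (φ n).continuous_normed (hρi n) (hρ0 n)
      (hρ1 n)

/-! ### Perimeter of unions and differences. -/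

theorem lintegral_enorm_convexComb_le {L M : Space d → Space d →L[ℝ] ℝ} {a b : Space d → ℝ}
    (hL : Measurable L) (ha : ∀ x, |a x| ≤ 1) (hb : ∀ x, |b x| ≤ 1) :
    ∫⁻ x, ‖a x • L x + b x • M x‖ₑ ≤ (∫⁻ x, ‖L x‖ₑ) + ∫⁻ x, ‖M x‖ₑ := by
  rw [← lintegral_add_left hL.enorm]
  refine lintegral_mono fun x => ?_
  have h : ∀ (c : ℝ) (l : Space d →L[ℝ] ℝ), |c| ≤ 1 → ‖c • l‖ ≤ ‖l‖ := by
    intro c l hc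
    rw [norm_smul]
    exact mul_le_of_le_one_left (norm_nonneg _) hc
  simp only [← ofReal_norm]
  rw [← ENNReal.ofReal_add (norm_nonneg _) (norm_nonneg _)]
  exact ENNReal.ofReal_le_ofReal
    ((norm_add_le _ _).trans (add_le_add (h _ _ (ha x)) (h _ _ (hb x))))

/-- With smooth approximations `u` and `v` of the two indicators, `u + v * (1 - u)` approximates
that of the union, and its gradient `(1 - v) ∇u + (1 - u) ∇v` has coefficients in `[0, 1]`. -/
theorem perimeter_union_le {A B : Set (Space d)} (hA : MeasurableSet A) (hB : MeasurableSet B)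
    (hbA : Bornology.IsBounded A) (hbB : Bornology.IsBounded B) :
    perimeter (A ∪ B) ≤ perimeter A + perimeter B := by
  obtain ⟨u, hu, huc, hu01, -, hul, hup⟩ := exists_smooth_approx hA hbA
  obtain ⟨v, hv, hvc, hv01, -, hvl, hvp⟩ := exists_smooth_approx hB hbB
  have hfd : ∀ n x, fderiv ℝ (fun y => u n y + v n y * (1 - u n y)) x
      = (1 - v n x) • fderiv ℝ (u n) x + (1 - u n x) • fderiv ℝ (v n) x := by
    intro n x
    have h1 := ((hu n).differentiable (by simp) x).hasFDerivAt
    have h2 := ((hv n).differentiable (by simp) x).hasFDerivAt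
    refine (h1.add (h2.mul (h1.const_sub 1))).fderiv.trans ?_
    module
  refine perimeter_le_of_tendsto (f := fun n y => u n y + v n y * (1 - u n y)) (hA.union hB)
    (fun n => ?_) (fun n x => ?_) ?_ (Eventually.of_forall fun n => ?_)
  · exact ContDiff.lipschitzWith_of_hasCompactSupport (n := ∞)
      ((huc n).add (hvc n).mul_right) ((hu n).add ((hv n).mul (contDiff_const.sub (hu n))))
      (by simp)
  · obtain ⟨h1, h2⟩ := hu01 n x
    obtain ⟨h3, h4⟩ := hv01 n x
    rw [abs_le]
    constructor <;> nlinarith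
  · filter_upwards [hul, hvl] with x h1 h2
    convert h1.add (h2.mul (h1.const_sub 1)) using 2
    by_cases hxA : x ∈ A <;> by_cases hxB : x ∈ B <;> simp [hxA, hxB]
  · simp only [hfd]
    refine (lintegral_enorm_convexComb_le (measurable_fderiv ℝ _) ?_ ?_).trans
      (add_le_add (hup n) (hvp n))
    · intro x
      obtain ⟨h3, h4⟩ := hv01 n x
      rw [abs_le]; constructor <;> linarith
    · intro x
      obtain ⟨h3, h4⟩ := hu01 n x
      rw [abs_le]; constructor <;> linarith

/-- Same argument as for unions, with `u * (1 - v)` as the approximation. -/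
theorem perimeter_diff_le {A B : Set (Space d)} (hA : MeasurableSet A) (hB : MeasurableSet B)
    (hbA : Bornology.IsBounded A) (hbB : Bornology.IsBounded B) :
    perimeter (A \ B) ≤ perimeter A + perimeter B := by
  obtain ⟨u, hu, huc, hu01, -, hul, hup⟩ := exists_smooth_approx hA hbA
  obtain ⟨v, hv, hvc, hv01, -, hvl, hvp⟩ := exists_smooth_approx hB hbB
  have hfd : ∀ n x, fderiv ℝ (fun y => u n y * (1 - v n y)) x
      = (1 - v n x) • fderiv ℝ (u n) x + (-u n x) • fderiv ℝ (v n) x := by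
    intro n x
    have h1 := ((hu n).differentiable (by simp) x).hasFDerivAt
    have h2 := ((hv n).differentiable (by simp) x).hasFDerivAt
    refine (h1.mul (h2.const_sub 1)).fderiv.trans ?_
    module
  refine perimeter_le_of_tendsto (f := fun n y => u n y * (1 - v n y)) (hA.diff hB)
    (fun n => ?_) (fun n x => ?_) ?_ (Eventually.of_forall fun n => ?_)
  · exact ContDiff.lipschitzWith_of_hasCompactSupport (n := ∞)
      (huc n).mul_right ((hu n).mul (contDiff_const.sub (hv n))) (by simp)
  · obtain ⟨h1, h2⟩ := hu01 n x
    obtain ⟨h3, h4⟩ := hv01 n x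
    rw [abs_le]
    constructor <;> nlinarith
  · filter_upwards [hul, hvl] with x h1 h2
    convert h1.mul (h2.const_sub 1) using 2
    by_cases hxA : x ∈ A <;> by_cases hxB : x ∈ B <;> simp [hxA, hxB]
  · simp only [hfd]
    refine (lintegral_enorm_convexComb_le (measurable_fderiv ℝ _) ?_ ?_).trans
      (add_le_add (hup n) (hvp n))
    · intro x
      obtain ⟨h3, h4⟩ := hv01 n x
      rw [abs_le]; constructor <;> linarith
    · intro x
      obtain ⟨h3, h4⟩ := hu01 n x
      rw [abs_le]; constructor <;> linarith

theorem perimeter_biUnion_finset_le {ι : Type*} (s : Finset ι) {A : ι → Set (Space d)}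
    (hA : ∀ i, MeasurableSet (A i)) (hb : ∀ i, Bornology.IsBounded (A i)) :
    perimeter (⋃ i ∈ s, A i) ≤ ∑ i ∈ s, perimeter (A i) := by
  classical
  induction s using Finset.induction_on with
  | empty => simp [perimeter_empty]
  | insert a s ha ih =>
    rw [Finset.set_biUnion_insert, Finset.sum_insert ha]
    refine (perimeter_union_le (hA a) (s.measurableSet_biUnion fun i _ => hA i) (hb a)
      ((Bornology.isBounded_biUnion_finset s).2 fun i _ => hb i)).trans ?_
    gcongr

/-- For each test field the integral over the union is the limit of those over finite unions, where
subadditivity is already known. -/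
theorem perimeter_iUnion_nat_le {A : ℕ → Set (Space d)}
    (hA : ∀ i, MeasurableSet (A i)) (hb : ∀ i, Bornology.IsBounded (A i)) :
    perimeter (⋃ i, A i) ≤ ∑' i, perimeter (A i) := by
  refine perimeter_le_iff.2 fun T hT => ?_
  have hmono : Monotone fun n : ℕ => ⋃ i ∈ Finset.range n, A i := by
    intro m n hmn
    exact biUnion_subset_biUnion_left fun i hi => by simp at hi ⊢; omega
  have hun : ⋃ n : ℕ, ⋃ i ∈ Finset.range n, A i = ⋃ i, A i := by
    ext x
    simp only [mem_iUnion, Finset.mem_range, exists_prop]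
    constructor
    · rintro ⟨n, i, -, h⟩; exact ⟨i, h⟩
    · rintro ⟨i, h⟩; exact ⟨i + 1, i, Nat.lt_succ_self i, h⟩
  have ht : Tendsto (fun n : ℕ => ∫ x in ⋃ i ∈ Finset.range n, A i, divergence T x) atTop
      (𝓝 (∫ x in ⋃ i, A i, divergence T x)) := by
    rw [← hun]
    exact tendsto_setIntegral_of_monotone
      (fun n => (Finset.range n).measurableSet_biUnion fun i _ => hA i) hmono
      hT.integrable_divergence.integrableOn
  refine le_of_tendsto ((ENNReal.continuous_ofReal.tendsto _).comp ht)
    (Eventually.of_forall fun n => ?_)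
  exact (hT.ofReal_le_perimeter _).trans ((perimeter_biUnion_finset_le _ hA hb).trans
    (ENNReal.sum_le_tsum _))

theorem closedBall_ae_eq_ball (x : Space d) {r : ℝ} (hr : r ≠ 0) :
    Metric.closedBall x r =ᵐ[volume] Metric.ball x r := by
  rw [← Metric.ball_union_sphere]
  exact union_ae_eq_left_of_ae_eq_empty
    (ae_eq_empty.2 (Measure.addHaar_sphere_of_ne_zero _ x hr))

/-! ### Outward vector fields and homeomorphisms pushing `Ω` into its interior. -/

/-- The vector `v` is strictly outward at `q`: small positive multiples of vectors close to `v`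
move points near `q` that are not interior to `Ω` out of `Ω`. -/
def IsOutwardAt (Ω : Set (Space d)) (q v : Space d) : Prop :=
  ∀ᶠ p : Space d × Space d × ℝ in 𝓝 (q, v, 0),
    0 < p.2.2 → p.1 ∉ interior Ω → p.1 + p.2.2 • p.2.1 ∉ Ω

/-- A step along a convex combination is a step along one vector followed by a step along the other.
The first leaves `Ω`, hence ends outside its interior, so the second applies. Convexity is what
permits gluing with a partition of unity. -/
theorem convex_isOutwardAt (Ω : Set (Space d)) (q : Space d) :
    Convex ℝ {v | IsOutwardAt Ω q v} := by
  rw [convex_iff_forall_pos]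
  intro v hv w hw a b ha hb hab
  have t1 : Tendsto (fun p : Space d × Space d × ℝ =>
      (p.1, v + (p.2.1 - (a • v + b • w)), a * p.2.2))
      (𝓝 (q, a • v + b • w, 0)) (𝓝 (q, v, 0)) := by
    refine Continuous.tendsto' (by fun_prop) _ _ (by simp)
  have t2 : Tendsto (fun p : Space d × Space d × ℝ =>
      (p.1 + (a * p.2.2) • (v + (p.2.1 - (a • v + b • w))),
        w + (p.2.1 - (a • v + b • w)), b * p.2.2))
      (𝓝 (q, a • v + b • w, 0)) (𝓝 (q, w, 0)) := by
    refine Continuous.tendsto' (by fun_prop) _ _ (by simp)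
  filter_upwards [t1.eventually hv, t2.eventually hw] with p h1 h2 hp hpi
  have h3 := h1 (mul_pos ha hp) hpi
  have h4 := h2 (mul_pos hb hp) fun h => h3 (interior_subset h)
  have heq : p.1 + p.2.2 • p.2.1 = p.1 + (a * p.2.2) • (v + (p.2.1 - (a • v + b • w)))
      + (b * p.2.2) • (w + (p.2.1 - (a • v + b • w))) := by
    have hb' : b = 1 - a := by linarith
    subst hb'
    module
  rw [heq]
  exact h4

/-- Any `v` with `dφ(q) v > 0` works: points that are not interior have `φ ≥ 0`, and strict
differentiability makes `φ` increase along all short steps in directions close to `v`. -/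
theorem HasSmoothBoundary.exists_isOutwardAt {Ω : Set (Space d)} (hΩ : HasSmoothBoundary Ω)
    {q : Space d} (hq : q ∈ frontier Ω) : ∃ v, IsOutwardAt Ω q v := by
  obtain ⟨U, φ, hU, hqU, hφ, hd, hUΩ⟩ := hΩ q hq
  obtain ⟨v, hv⟩ : ∃ v, 0 < fderiv ℝ φ q v := by
    obtain ⟨w, hw⟩ : ∃ w, fderiv ℝ φ q w ≠ 0 := by
      by_contra! h
      exact hd (ContinuousLinearMap.ext h)
    rcases hw.lt_or_gt with h | h
    · exact ⟨-w, by simpa using h⟩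
    · exact ⟨w, h⟩
  refine ⟨v, ?_⟩
  have hstrict : HasStrictFDerivAt φ (fderiv ℝ φ q) q :=
    (hφ.contDiffAt (hU.mem_nhds hqU)).hasStrictFDerivAt (by simp)
  -- The linearisation error is at most `c` times the step length, and `c` is small enough to stay
  -- below the gain `dφ(q) v`; the `+ 1` avoids a vanishing denominator.
  let c : ℝ := fderiv ℝ φ q v / (2 * (‖v‖ + 1))
  have hc : 0 < c := by positivity
  have hcv : c * ‖v‖ < fderiv ℝ φ q v := by
    rw [div_mul_eq_mul_div, div_lt_iff₀ (by positivity)]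
    nlinarith [norm_nonneg v]
  have t1 : Tendsto (fun p : Space d × Space d × ℝ => (p.1 + p.2.2 • p.2.1, p.1))
      (𝓝 (q, v, 0)) (𝓝 (q, q)) :=
    Continuous.tendsto' (by fun_prop) _ _ (by simp)
  have t2 : Tendsto (fun p : Space d × Space d × ℝ => p.1) (𝓝 (q, v, 0)) (𝓝 q) :=
    continuous_fst.tendsto' _ _ rfl
  have t3 : Tendsto (fun p : Space d × Space d × ℝ => p.1 + p.2.2 • p.2.1)
      (𝓝 (q, v, 0)) (𝓝 q) :=
    Continuous.tendsto' (by fun_prop) _ _ (by simp)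
  have e1 := t1.eventually (hstrict.isLittleO.def hc)
  have e2 := t2.eventually (hU.mem_nhds hqU)
  have e3 := t3.eventually (hU.mem_nhds hqU)
  have e4 : ∀ᶠ p : Space d × Space d × ℝ in 𝓝 (q, v, 0), c * ‖p.2.1‖ < fderiv ℝ φ q p.2.1 := by
    refine ContinuousAt.eventually_lt ?_ ?_ (by exact hcv)
    · exact Continuous.continuousAt (by fun_prop)
    · exact Continuous.continuousAt (by fun_prop)
  filter_upwards [e1, e2, e3, e4] with p h1 h2 h3 h4 hp hpi hmem
  have h5 : φ (p.1 + p.2.2 • p.2.1) ≤ 0 := by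
    have : p.1 + p.2.2 • p.2.1 ∈ Ω ∩ U := ⟨hmem, h3⟩
    rw [hUΩ] at this
    exact this.2
  have h6 : 0 ≤ φ p.1 := by
    by_contra! hneg
    apply hpi
    rw [mem_interior_iff_mem_nhds]
    have hcont : ContinuousAt φ p.1 := hφ.continuousOn.continuousAt (hU.mem_nhds h2)
    filter_upwards [hcont.eventually_lt continuousAt_const hneg, hU.mem_nhds h2] with y hy hyU
    have : y ∈ {y ∈ U | φ y ≤ 0} := ⟨hyU, hy.le⟩
    rw [← hUΩ] at this
    exact this.1
  simp only [add_sub_cancel_left, map_smul, smul_eq_mul, norm_smul, Real.norm_eq_abs,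
    abs_of_pos hp] at h1
  have h7 := (abs_le.1 h1).1
  nlinarith

/-- A compact set with smooth boundary admits a smooth vector field whose short time steps move
the complement of its interior off the set. -/
theorem HasSmoothBoundary.exists_outward_field {Ω : Set (Space d)} (hΩ : HasSmoothBoundary Ω)
    (hc : IsCompact Ω) : ∃ W : Space d → Space d, ContDiff ℝ ∞ W ∧ HasCompactSupport W ∧
      ∀ᶠ s in 𝓝 (0 : ℝ), 0 < s → ∀ x, x ∉ interior Ω → x + s • W x ∉ Ω := by
  let t : Space d → Set (Space d) := fun x => {v | x ∈ frontier Ω → IsOutwardAt Ω x v}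
  have ht : ∀ x, Convex ℝ (t x) := by
    intro x
    by_cases hx : x ∈ frontier Ω
    · simpa only [t, hx, true_imp_iff] using convex_isOutwardAt Ω x
    · simpa [t, hx] using convex_univ
  have hloc : ∀ x, ∃ c, ∀ᶠ y in 𝓝 x, c ∈ t y := by
    intro x
    by_cases hx : x ∈ frontier Ω
    · obtain ⟨v, hv⟩ := hΩ.exists_isOutwardAt hx
      refine ⟨v, ?_⟩
      have h1 := hv.eventually_nhds
      have h2 : Tendsto (fun y : Space d => (y, v, (0 : ℝ))) (𝓝 x) (𝓝 (x, v, 0)) :=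
        Continuous.tendsto' (by fun_prop) _ _ rfl
      filter_upwards [h2.eventually h1] with y hy _ using hy
    · refine ⟨0, ?_⟩
      filter_upwards [isClosed_frontier.isOpen_compl.mem_nhds hx] with y hy h using absurd h hy
  -- A vector outward at `x` remains outward at nearby boundary points, so locally constant choices
  -- exist and glue smoothly by convexity.
  obtain ⟨g, hg⟩ := exists_contMDiffMap_forall_mem_convex_of_local_const
    (modelWithCornersSelf ℝ (Space d)) (n := ⊤) ht hloc
  have hgs : ContDiff ℝ ∞ g := g.contMDiff.contDiff
  obtain ⟨R, hR⟩ := hc.isBounded.subset_closedBall (0 : Space d)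
  let χ : ContDiffBump (0 : Space d) := ⟨|R| + 1, |R| + 2, by positivity, by linarith⟩
  let W : Space d → Space d := fun x => χ x • g x
  have hWs : ContDiff ℝ ∞ W := χ.contDiff.smul hgs
  have hWc : HasCompactSupport W := χ.hasCompactSupport.smul_right
  refine ⟨W, hWs, hWc, ?_⟩
  have hfr : ∀ q ∈ frontier Ω, W q = g q := by
    intro q hq
    have hqR : q ∈ Metric.closedBall (0 : Space d) (|R| + 1) := by
      refine Metric.closedBall_subset_closedBall ?_ (hR (hc.isClosed.frontier_subset hq))
      linarith [le_abs_self R]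
    simp only [W, χ.one_of_mem_closedBall hqR, one_smul]
  -- Off this compact set nothing moves and no point lies in `Ω`, so uniformity in the step size is
  -- only needed on `K`.
  let K := tsupport W ∪ Ω
  have hK : IsCompact K := hWc.isCompact.union hc
  have hev : ∀ᶠ s in 𝓝 (0 : ℝ), ∀ x ∈ K, 0 < s → x ∉ interior Ω → x + s • W x ∉ Ω := by
    refine hK.eventually_forall_of_forall_eventually fun q _ => ?_
    have tW : Tendsto (fun z : ℝ × Space d => z.2 + z.1 • W z.2) (𝓝 (0, q)) (𝓝 q) :=
      Continuous.tendsto' (by have := hWs.continuous; fun_prop) _ _ (by simp)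
    by_cases hq : q ∈ frontier Ω
    · have ho : IsOutwardAt Ω q (W q) := by rw [hfr q hq]; exact hg q hq
      have t1 : Tendsto (fun z : ℝ × Space d => (z.2, W z.2, z.1)) (𝓝 (0, q))
          (𝓝 (q, W q, 0)) :=
        Continuous.tendsto' (by have := hWs.continuous; fun_prop) _ _ rfl
      exact t1.eventually ho
    · by_cases hqi : q ∈ interior Ω
      · have t2 : Tendsto (fun z : ℝ × Space d => z.2) (𝓝 (0, q)) (𝓝 q) :=
          continuous_snd.tendsto' _ _ rfl
        filter_upwards [t2.eventually (isOpen_interior.mem_nhds hqi)] with z hz _ h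
          using absurd hz h
      · have hqΩ : q ∉ Ω := fun h => hq ⟨subset_closure h, hqi⟩
        filter_upwards [tW.eventually (hc.isClosed.isOpen_compl.mem_nhds hqΩ)] with z hz _ _
          using hz
  filter_upwards [hev] with s hs hs0 x hx
  by_cases hxK : x ∈ K
  · exact hs x hxK hs0 hx
  · have h1 : W x = 0 := image_eq_zero_of_notMem_tsupport fun h => hxK (Or.inl h)
    rw [h1, smul_zero, add_zero]
    exact fun h => hxK (Or.inr h)

/-- Compact sets with smooth boundary are moved into their interior by a homeomorphism which is
arbitrarily close to the identity; we record its inverse. -/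
theorem HasSmoothBoundary.exists_homeomorph {Ω : Set (Space d)} (hΩ : HasSmoothBoundary Ω)
    (hc : IsCompact Ω) {ε : ℝ≥0} (hε : 0 < ε) (hε1 : ε < 1) :
    ∃ Ψ : Space d ≃ₜ Space d, ContDiff ℝ ∞ Ψ ∧ LipschitzWith (1 + ε) Ψ ∧
      AntilipschitzWith (1 - ε)⁻¹ Ψ ∧ (∀ x, dist (Ψ x) x ≤ ε) ∧
      ∀ x, x ∉ interior Ω → Ψ x ∉ Ω := by
  obtain ⟨W, hWs, hWc, hW⟩ := hΩ.exists_outward_field hc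
  obtain ⟨C, hC⟩ := ContDiff.lipschitzWith_of_hasCompactSupport hWc hWs (by simp)
  obtain ⟨B, hB⟩ := hWc.exists_bound_of_continuous hWs.continuous
  have e1 : ∀ᶠ s : ℝ in 𝓝 0, s * (C : ℝ) < (ε : ℝ) :=
    ContinuousAt.eventually_lt (by fun_prop) continuousAt_const (by simpa using hε)
  have e2 : ∀ᶠ s : ℝ in 𝓝 0, s * B < (ε : ℝ) :=
    ContinuousAt.eventually_lt (by fun_prop) continuousAt_const (by simpa using hε)
  obtain ⟨s, ⟨⟨hs1, hs2⟩, hs3⟩, hs0⟩ := (((e1.and e2).and hW).filter_mono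
    (nhdsWithin_le_nhds (s := Ioi 0))).and self_mem_nhdsWithin |>.exists
  have hs0 : 0 < s := hs0
  -- A perturbation of the identity with Lipschitz constant `ε < 1` is a homeomorphism. Since `f`
  -- throws the complement of the interior off `Ω`, its inverse sends `Ω` into the interior.
  let f : Space d → Space d := fun x => x + s • W x
  have hWlip : ∀ x y, ‖s • W x - s • W y‖ ≤ ε * ‖x - y‖ := by
    intro x y
    rw [← smul_sub, norm_smul, Real.norm_eq_abs, abs_of_pos hs0]
    calc s * ‖W x - W y‖ ≤ s * (C * ‖x - y‖) := by
          gcongr; simpa [dist_eq_norm] using hC.dist_le_mul x y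
      _ = s * C * ‖x - y‖ := by ring
      _ ≤ ε * ‖x - y‖ := by gcongr
  have happ : ApproximatesLinearOn f
      ((ContinuousLinearEquiv.refl ℝ (Space d) : Space d ≃L[ℝ] Space d) :
        Space d →L[ℝ] Space d) univ ε := by
    rw [ApproximatesLinearOn.approximatesLinearOn_iff_lipschitzOnWith, lipschitzOnWith_univ]
    refine LipschitzWith.of_dist_le_mul fun x y => ?_
    simpa [f, dist_eq_norm] using hWlip x y
  have hanti : AntilipschitzWith (1 - ε)⁻¹ f := by
    refine AntilipschitzWith.of_le_mul_dist fun x y => ?_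
    have h1ε : (0 : ℝ) < 1 - ε := by simpa using hε1
    rw [NNReal.coe_inv, NNReal.coe_sub hε1.le, NNReal.coe_one, inv_mul_eq_div, le_div_iff₀ h1ε]
    have h1 := hWlip x y
    have h2 : ‖x - y‖ ≤ ‖f x - f y‖ + ‖s • W x - s • W y‖ := by
      have : x - y = (f x - f y) - (s • W x - s • W y) := by simp only [f]; abel
      rw [this]
      exact norm_sub_le _ _
    rw [dist_eq_norm, dist_eq_norm]
    linarith
  have hcond : Subsingleton (Space d) ∨
      ε < ‖((ContinuousLinearEquiv.refl ℝ (Space d)).symm : Space d →L[ℝ] Space d)‖₊⁻¹ := by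
    rcases subsingleton_or_nontrivial (Space d) with h | h
    · exact Or.inl h
    · right
      have : ‖((ContinuousLinearEquiv.refl ℝ (Space d)).symm : Space d →L[ℝ] Space d)‖₊ = 1 := by
        ext
        exact ContinuousLinearMap.norm_id
      rw [this, inv_one]
      exact hε1
  let Ψ : Space d ≃ₜ Space d := happ.toHomeomorph f hcond
  have hΨ : ∀ x, Ψ x = f x := fun x => rfl
  have hΨ' : (Ψ : Space d → Space d) = f := rfl
  refine ⟨Ψ, ?_, ?_, ?_, fun x => ?_, fun x hx => ?_⟩
  · rw [hΨ']
    exact contDiff_id.add (hWs.const_smul s)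
  · rw [hΨ']
    refine LipschitzWith.of_dist_le_mul fun x y => ?_
    have h1 := hWlip x y
    have h2 : ‖f x - f y‖ ≤ ‖x - y‖ + ‖s • W x - s • W y‖ := by
      have : f x - f y = (x - y) + (s • W x - s • W y) := by simp only [f]; abel
      rw [this]
      exact norm_add_le _ _
    rw [dist_eq_norm, dist_eq_norm, NNReal.coe_add, NNReal.coe_one]
    linarith
  · rw [hΨ']; exact hanti
  · rw [hΨ, dist_eq_norm]
    simp only [f, add_sub_cancel_left, norm_smul, Real.norm_eq_abs, abs_of_pos hs0]
    calc s * ‖W x‖ ≤ s * B := by gcongr; exact hB x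
      _ ≤ ε := hs2.le
  · exact hs3 hs0 x hx

/-! ### Volume distortion and approximation by open subsets of `Ω`. -/

/-- Lebesgue measure is a multiple of the `d`-dimensional Hausdorff measure, for which antilipschitz
maps satisfy this bound. -/
theorem volume_preimage_le {K : ℝ≥0} {f : Space d → Space d} (hf : AntilipschitzWith K f)
    (s : Set (Space d)) : volume (f ⁻¹' s) ≤ (K : ℝ≥0∞) ^ d * volume s := by
  have hH : (Measure.hausdorffMeasure (d : ℝ) : Measure (Space d)).IsAddHaarMeasure := by
    have h := isAddHaarMeasure_hausdorffMeasure (E := Space d)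
    rwa [finrank_euclideanSpace_fin] at h
  rw [Measure.isAddLeftInvariant_eq_smul (volume : Measure (Space d))
    (Measure.hausdorffMeasure (d : ℝ)), Measure.smul_apply, Measure.smul_apply]
  have h := hf.hausdorffMeasure_preimage_le (Nat.cast_nonneg d) s
  rw [ENNReal.rpow_natCast] at h
  rw [ENNReal.smul_def, ENNReal.smul_def, smul_eq_mul, smul_eq_mul, mul_left_comm]
  gcongr

theorem lintegral_comp_le {K : ℝ≥0} {f : Space d → Space d} (hf : AntilipschitzWith K f)
    (hfm : Measurable f) {g : Space d → ℝ≥0∞} (hg : Measurable g) :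
    ∫⁻ x, g (f x) ≤ (K : ℝ≥0∞) ^ d * ∫⁻ x, g x := by
  rw [← lintegral_map hg hfm, ← lintegral_const_mul _ hg]
  have hle : Measure.map f volume ≤ ((K : ℝ≥0∞) ^ d) • (volume : Measure (Space d)) := by
    refine Measure.le_iff.2 fun s hs => ?_
    rw [Measure.map_apply hfm hs, Measure.smul_apply, smul_eq_mul]
    exact volume_preimage_le hf s
  refine (lintegral_mono' hle le_rfl).trans (le_of_eq ?_)
  rw [lintegral_smul_measure, lintegral_const_mul _ hg, smul_eq_mul]

/-- Homeomorphisms close to the identity which do not contract too much move a set of finite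
measure by a set of small measure. -/
theorem exists_volume_symmDiff_preimage_le {E : Set (Space d)} (hE : MeasurableSet E)
    (hfin : volume E ≠ ⊤) (C : ℝ≥0) {η : ℝ≥0∞} (hη : η ≠ 0) :
    ∃ θ : ℝ≥0, 0 < θ ∧ ∀ f : Space d → Space d, Continuous f → AntilipschitzWith C f →
      (∀ x, dist (f x) x ≤ θ) → volume (symmDiff (f ⁻¹' E) E) ≤ η := by
  let c : ℝ≥0∞ := 2 * (C : ℝ≥0∞) ^ d + 2
  have hc0 : c ≠ 0 := by simp [c]
  have hctop : c ≠ ⊤ := by simp [c, ENNReal.mul_eq_top]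
  let ζ := η / c
  have hζ : ζ ≠ 0 := ENNReal.div_ne_zero.2 ⟨hη, hctop⟩
  -- With `K ⊆ E ⊆ U` and the `θ`-neighbourhood of `K` inside `U`, a point can change sides only if
  -- it or its image lies in `E \ K` or `U \ E`.
  obtain ⟨K, hKE, hK, hEK⟩ := hE.exists_isCompact_sdiff_lt hfin hζ
  obtain ⟨U, hEU, hU, -, hUE⟩ := hE.exists_isOpen_sdiff_lt hfin hζ
  obtain ⟨θ, hθ, hθU⟩ := hK.exists_cthickening_subset_open hU (hKE.trans hEU)
  refine ⟨⟨θ, hθ.le⟩, hθ, fun f hf hanti hdist => ?_⟩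
  have hsub : symmDiff (f ⁻¹' E) E
      ⊆ (f ⁻¹' (E \ K) ∪ f ⁻¹' (U \ E)) ∪ ((U \ E) ∪ (E \ K)) := by
    rintro x (⟨h1, h2⟩ | ⟨h1, h2⟩)
    · by_cases hxK : f x ∈ K
      · refine Or.inr (Or.inl ⟨hθU ?_, h2⟩)
        exact Metric.mem_cthickening_of_dist_le x (f x) θ K hxK
          (by rw [dist_comm]; exact hdist x)
      · exact Or.inl (Or.inl ⟨h1, hxK⟩)
    · by_cases hxK : x ∈ K
      · refine Or.inl (Or.inr ⟨hθU ?_, h2⟩)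
        exact Metric.mem_cthickening_of_dist_le (f x) x θ K hxK (hdist x)
      · exact Or.inr (Or.inr ⟨h1, hxK⟩)
  calc volume (symmDiff (f ⁻¹' E) E)
      ≤ (volume (f ⁻¹' (E \ K)) + volume (f ⁻¹' (U \ E)))
          + (volume (U \ E) + volume (E \ K)) :=
        (measure_mono hsub).trans ((measure_union_le _ _).trans
          (add_le_add (measure_union_le _ _) (measure_union_le _ _)))
    _ ≤ ((C : ℝ≥0∞) ^ d * ζ + (C : ℝ≥0∞) ^ d * ζ) + (ζ + ζ) := by
        gcongr
        · exact (volume_preimage_le hanti _).trans (by gcongr)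
        · exact (volume_preimage_le hanti _).trans (by gcongr)
    _ = c * ζ := by simp only [c]; ring
    _ = η := ENNReal.mul_div_cancel hc0 hctop

/-- This turns convergence in measure into convergence of superlevel sets, uniformly over levels in
`[κ, 1 - κ]`. -/
theorem symmDiff_superlevel_subset {E : Set (Space d)} {u : Space d → ℝ} {κ τ : ℝ}
    (hκ : κ ≤ τ) (hτ : τ ≤ 1 - κ) :
    symmDiff {x | τ < u x} E ⊆ {x | κ ≤ dist (u x) (E.indicator 1 x)} := by
  rintro x (⟨h1, h2⟩ | ⟨h1, h2⟩)
  · have h1 : τ < u x := h1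
    simp only [mem_ofPred_eq, indicator_of_notMem h2, Real.dist_eq, sub_zero]
    exact le_abs.2 (Or.inl (by linarith))
  · have h2 : u x ≤ τ := not_lt.1 h2
    simp only [mem_ofPred_eq, indicator_of_mem h1, Real.dist_eq, Pi.one_apply]
    exact le_abs.2 (Or.inr (by linarith))

/-- Sets of finite perimeter in a compact set with smooth boundary are approximated by open
subsets. -/
theorem HasSmoothBoundary.exists_open_approx {Ω : Set (Space d)} (hΩ : HasSmoothBoundary Ω)
    (hc : IsCompact Ω) {E : Set (Space d)} (hE : MeasurableSet E) (hEΩ : E ⊆ Ω)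
    (hP : perimeter E ≠ ⊤) {ε : ℝ≥0∞} (hε : ε ≠ 0) :
    ∃ A, IsOpen A ∧ A ⊆ Ω ∧ perimeter A ≤ perimeter E + ε ∧ volume (symmDiff A E) ≤ ε := by
  have hEb : Bornology.IsBounded E := hc.isBounded.subset hEΩ
  have hEfin : volume E ≠ ⊤ := hEb.measure_lt_top.ne
  -- The factor `1 + κ` comes from the Lipschitz constant of `Ψ`, `(1 - κ)⁻¹ ^ d` from the change of
  -- variables, and `1 - 2 * κ` is the length of the interval of levels in the coarea inequality.
  obtain ⟨κ, hκ0, hκ2, hκP⟩ : ∃ κ : ℝ, 0 < κ ∧ κ < 1 / 2 ∧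
      ENNReal.ofReal ((1 + κ) * ((1 - κ)⁻¹) ^ d / (1 - 2 * κ)) * perimeter E
        < perimeter E + ε := by
    have hcont : ContinuousAt (fun κ : ℝ => (1 + κ) * ((1 - κ)⁻¹) ^ d / (1 - 2 * κ)) 0 := by
      refine ContinuousAt.div (ContinuousAt.mul (by fun_prop) (ContinuousAt.pow
        (ContinuousAt.inv₀ (by fun_prop) (by simp)) d)) (by fun_prop) (by simp)
    have ht := ENNReal.Tendsto.mul_const (b := perimeter E)
      ((ENNReal.continuous_ofReal.tendsto _).comp hcont.tendsto) (Or.inr hP)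
    simp only [Function.comp_def, add_zero, sub_zero, inv_one, one_pow, mul_one, mul_zero,
      div_one, ENNReal.ofReal_one, one_mul] at ht
    have h1 := ht.eventually (gt_mem_nhds (ENNReal.lt_add_right hP hε))
    have h2 : ∀ᶠ κ : ℝ in 𝓝 0, κ < 1 / 2 := gt_mem_nhds (by norm_num)
    obtain ⟨κ, ⟨h3, h4⟩, h5⟩ := ((h1.and h2).filter_mono
      (nhdsWithin_le_nhds (s := Ioi 0))).and self_mem_nhdsWithin |>.exists
    exact ⟨κ, h5, h4, h3⟩
  have hε2 : ε / 2 ≠ 0 := (ENNReal.half_pos hε).ne'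
  obtain ⟨θ₀, hθ₀, hθ₀E⟩ := exists_volume_symmDiff_preimage_le hE hEfin 2 hε2
  let θ : ℝ≥0 := min θ₀ ⟨κ, hκ0.le⟩
  have hθ0 : 0 < θ := lt_min hθ₀ hκ0
  have hθκ : (θ : ℝ) ≤ κ := by
    have : θ ≤ ⟨κ, hκ0.le⟩ := min_le_right _ _
    exact_mod_cast this
  have hθ1 : θ < 1 := by
    have : (θ : ℝ) < 1 := by linarith
    exact_mod_cast this
  obtain ⟨Ψ, hΨs, hΨlip, hΨanti, hΨd, hΨΩ⟩ := hΩ.exists_homeomorph hc hθ0 hθ1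
  have hΨanti2 : AntilipschitzWith 2 Ψ := by
    have h2 : (1 - θ)⁻¹ ≤ 2 := ?_
    · exact fun x y => (hΨanti x y).trans (by gcongr)
    rw [inv_le_comm₀ (tsub_pos_of_lt hθ1) two_pos]
    rw [← NNReal.coe_le_coe, NNReal.coe_sub hθ1.le]
    push_cast
    linarith
  obtain ⟨u, hu, huc, hu01, hus, hul, hup⟩ := exists_smooth_approx hE hEb
  -- The gap between these sets makes `u n ∘ Ψ` vanish off the interior of `Ω` once the
  -- mollification radius is below it.
  have hdisj : Disjoint Ω (Ψ '' (interior Ω)ᶜ) := by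
    rw [Set.disjoint_left]
    rintro _ h ⟨x, hx, rfl⟩
    exact hΨΩ x hx h
  obtain ⟨δ, hδ, hδd⟩ := hdisj.exists_thickenings hc
    (Ψ.isClosedMap _ isOpen_interior.isClosed_compl)
  have hn1 : ∀ᶠ n : ℕ in atTop, 2 / ((n : ℝ) + 1) < δ := by
    have : Tendsto (fun n : ℕ => 2 * (1 / ((n : ℝ) + 1))) atTop (𝓝 (2 * 0)) :=
      tendsto_one_div_add_atTop_nhds_zero_nat.const_mul 2
    rw [mul_zero] at this
    filter_upwards [this.eventually (gt_mem_nhds hδ)] with n hn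
    rwa [mul_one_div] at hn
  -- Almost everywhere convergence gives convergence in measure only on a set of finite measure; all
  -- functions vanish off `B`. The divisor `2 ^ d` compensates for the distortion of volume by `Ψ`.
  have hn2 : ∀ᶠ n : ℕ in atTop,
      volume {x | κ ≤ dist (u n x) (E.indicator 1 x)} ≤ ε / 2 / 2 ^ d := by
    let B := Metric.thickening 2 E
    have hB : Bornology.IsBounded B := hEb.thickening
    have : IsFiniteMeasure (volume.restrict B) :=
      ⟨by rw [Measure.restrict_apply_univ]; exact hB.measure_lt_top⟩
    have hm := tendstoInMeasure_of_tendsto_ae (μ := volume.restrict B) (f := u)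
      (g := E.indicator 1) (fun n => (hu n).continuous.aestronglyMeasurable)
      (ae_restrict_of_ae hul)
    rw [tendstoInMeasure_iff_dist] at hm
    have hpos : (0 : ℝ≥0∞) < ε / 2 / 2 ^ d :=
      ENNReal.div_pos hε2 (ENNReal.pow_ne_top ENNReal.ofNat_ne_top)
    filter_upwards [(hm κ hκ0).eventually (gt_mem_nhds hpos)] with n hn
    refine le_trans (le_of_eq ?_) hn.le
    rw [Measure.restrict_eq_self]
    intro x hx
    by_contra hxB
    have hxE : x ∉ E := fun h => hxB (Metric.self_subset_thickening two_pos E h)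
    have hux : u n x = 0 := by
      by_contra hne
      refine hxB (Metric.thickening_mono ?_ E (hus n hne))
      rw [div_le_iff₀ (by positivity)]
      have : (0 : ℝ) ≤ n := Nat.cast_nonneg n
      linarith
    have hx' : κ ≤ dist (u n x) (E.indicator 1 x) := hx
    rw [indicator_of_notMem hxE, hux, dist_self] at hx'
    linarith
  obtain ⟨n, hnδ, hnv⟩ := (hn1.and hn2).exists
  let w : Space d → ℝ := fun x => u n (Ψ x)
  have hud : Differentiable ℝ (u n) := (hu n).differentiable (by simp)
  have hΨdiff : Differentiable ℝ Ψ := hΨs.differentiable (by simp)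
  obtain ⟨C, hC⟩ := ContDiff.lipschitzWith_of_hasCompactSupport (huc n) (hu n) (by simp)
  have hwint : ∫⁻ x, ‖fderiv ℝ w x‖ₑ
      ≤ ENNReal.ofReal ((1 + κ) * ((1 - κ)⁻¹) ^ d) * perimeter E := by
    have hpt : ∀ x, ‖fderiv ℝ w x‖ₑ ≤ ENNReal.ofReal (1 + κ) * ‖fderiv ℝ (u n) (Ψ x)‖ₑ := by
      intro x
      have h1 : fderiv ℝ w x = (fderiv ℝ (u n) (Ψ x)).comp (fderiv ℝ Ψ x) :=
        fderiv_comp x (hud _) (hΨdiff x)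
      rw [h1, ← ofReal_norm, ← ofReal_norm, ← ENNReal.ofReal_mul (by linarith)]
      refine ENNReal.ofReal_le_ofReal ((ContinuousLinearMap.opNorm_comp_le _ _).trans ?_)
      rw [mul_comm]
      gcongr
      refine (norm_fderiv_le_of_lipschitz ℝ hΨlip).trans ?_
      push_cast
      linarith
    have hmeas : Measurable fun x => ‖fderiv ℝ (u n) x‖ₑ := (measurable_fderiv ℝ (u n)).enorm
    calc ∫⁻ x, ‖fderiv ℝ w x‖ₑ
        ≤ ∫⁻ x, ENNReal.ofReal (1 + κ) * ‖fderiv ℝ (u n) (Ψ x)‖ₑ := lintegral_mono hpt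
      _ = ENNReal.ofReal (1 + κ) * ∫⁻ x, ‖fderiv ℝ (u n) (Ψ x)‖ₑ :=
          lintegral_const_mul _ (hmeas.comp Ψ.continuous.measurable)
      _ ≤ ENNReal.ofReal (1 + κ) * ((((1 - θ)⁻¹ : ℝ≥0) : ℝ≥0∞) ^ d * perimeter E) := by
          gcongr
          exact (lintegral_comp_le hΨanti Ψ.continuous.measurable hmeas).trans
            (by gcongr; exact hup n)
      _ ≤ ENNReal.ofReal (1 + κ) * (ENNReal.ofReal ((1 - κ)⁻¹) ^ d * perimeter E) := by
          gcongr
          rw [← ENNReal.ofReal_coe_nnreal]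
          refine ENNReal.ofReal_le_ofReal ?_
          rw [NNReal.coe_inv, NNReal.coe_sub hθ1.le, NNReal.coe_one]
          gcongr
          linarith
      _ = _ := by
          rw [ENNReal.ofReal_mul (by linarith), ENNReal.ofReal_pow (by
            rw [inv_nonneg]; linarith), mul_assoc]
  obtain ⟨τ, ⟨hτ1, hτ2⟩, hτP⟩ := exists_perimeter_superlevel_le (hC.comp hΨlip)
    (hud.comp hΨdiff) (a := κ) (b := 1 - κ) (by linarith)
  refine ⟨{x | τ < w x}, ?_, ?_, ?_, ?_⟩
  · exact isOpen_lt continuous_const ((hu n).continuous.comp Ψ.continuous)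
  · intro x hx
    have hx : τ < w x := hx
    by_contra hxΩ
    have h1 : Ψ x ∈ Metric.thickening δ Ω := by
      refine Metric.thickening_mono hnδ.le Ω (Metric.thickening_subset_of_subset _ hEΩ (hus n ?_))
      have : 0 < w x := by linarith
      exact this.ne'
    have h2 : Ψ x ∈ Metric.thickening δ (Ψ '' (interior Ω)ᶜ) :=
      Metric.self_subset_thickening hδ _ ⟨x, fun h => hxΩ (interior_subset h), rfl⟩
    exact Set.disjoint_left.1 hδd h1 h2
  · have hpos : 0 < 1 - 2 * κ := by linarith
    have h0 : ENNReal.ofReal (1 - κ - κ) ≠ 0 := by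
      simp only [ne_eq, ENNReal.ofReal_eq_zero, not_le]; linarith
    have h1 := hτP.trans hwint
    rw [mul_comm, ← ENNReal.le_div_iff_mul_le (Or.inl h0) (Or.inl ENNReal.ofReal_ne_top)] at h1
    refine h1.trans (le_trans (le_of_eq ?_) hκP.le)
    rw [show 1 - κ - κ = 1 - 2 * κ by ring, ENNReal.ofReal_div_of_pos hpos, div_eq_mul_inv,
      div_eq_mul_inv, mul_right_comm]
  · have h1 : {x | τ < w x} = Ψ ⁻¹' {x | τ < u n x} := rfl
    have h2 : volume (symmDiff {x | τ < w x} (Ψ ⁻¹' E)) ≤ ε / 2 := by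
      rw [h1, ← Set.preimage_symmDiff]
      refine (volume_preimage_le hΨanti2 _).trans ?_
      refine (mul_le_mul_right ((measure_mono (symmDiff_superlevel_subset hτ1.le hτ2.le)).trans
        hnv) _).trans (le_of_eq ?_)
      exact ENNReal.mul_div_cancel (by simp) (ENNReal.pow_ne_top ENNReal.coe_ne_top)
    have h3 : volume (symmDiff (Ψ ⁻¹' E) E) ≤ ε / 2 :=
      hθ₀E Ψ Ψ.continuous hΨanti2 fun x => (hΨd x).trans (by
        have : θ ≤ θ₀ := min_le_left _ _
        exact_mod_cast this)
    calc volume (symmDiff {x | τ < w x} E)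
        ≤ volume (symmDiff {x | τ < w x} (Ψ ⁻¹' E)) + volume (symmDiff (Ψ ⁻¹' E) E) :=
          measure_symmDiff_le _ _ _
      _ ≤ ε / 2 + ε / 2 := add_le_add h2 h3
      _ = ε := ENNReal.add_halves ε

/-! ### Elementary properties of the Riesz energy. -/

theorem rpow_neg_le_of_le_mul {a b c : ℝ≥0∞} {α : ℝ} (hα : 0 ≤ α) (hc0 : c ≠ 0) (hc : c ≠ ⊤)
    (h : a ≤ c * b) : b ^ (-α) ≤ c ^ α * a ^ (-α) := by
  have h0 : c ^ α ≠ 0 := by simp [ENNReal.rpow_eq_zero_iff, hc0, hc]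
  have h1 : c ^ α ≠ ⊤ := ENNReal.rpow_ne_top_of_nonneg hα hc
  have h2 : a ^ α ≤ c ^ α * b ^ α := by
    rw [← ENNReal.mul_rpow_of_nonneg _ _ hα]
    exact ENNReal.rpow_le_rpow h hα
  rw [ENNReal.rpow_neg, ENNReal.rpow_neg]
  calc (b ^ α)⁻¹ = c ^ α * ((c ^ α)⁻¹ * (b ^ α)⁻¹) := by
        rw [← mul_assoc, ENNReal.mul_inv_cancel h0 h1, one_mul]
    _ = c ^ α * (c ^ α * b ^ α)⁻¹ := by rw [ENNReal.mul_inv (Or.inl h0) (Or.inl h1)]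
    _ ≤ c ^ α * (a ^ α)⁻¹ := by gcongr

theorem rpow_neg_le_rpow_neg {a b : ℝ≥0∞} {α : ℝ} (hα : 0 ≤ α) (h : a ≤ b) :
    b ^ (-α) ≤ a ^ (-α) := by
  rw [ENNReal.rpow_neg, ENNReal.rpow_neg]
  exact ENNReal.inv_le_inv.2 (ENNReal.rpow_le_rpow h hα)

theorem measurable_rieszKernel (α : ℝ) :
    Measurable fun p : Space d × Space d => edist p.1 p.2 ^ (-α) :=
  (measurable_edist).pow_const _

theorem measurable_rieszKernel_right (α : ℝ) (x : Space d) :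
    Measurable fun y : Space d => edist x y ^ (-α) :=
  measurable_edist_right.pow_const _

theorem rieszInteraction_mono {α : ℝ} {μ ν : Measure (Space d)} (h : μ ≤ ν) :
    rieszInteraction α μ μ ≤ rieszInteraction α ν ν :=
  lintegral_mono' h fun _ => lintegral_mono' h le_rfl

theorem rieszInteraction_smul_smul (α : ℝ) (c : ℝ≥0∞) (μ ν : Measure (Space d))
    [SFinite ν] :
    rieszInteraction α (c • μ) (c • ν) = c ^ 2 * rieszInteraction α μ ν := by
  simp only [rieszInteraction, lintegral_smul_measure, smul_eq_mul]
  rw [lintegral_const_mul _ (measurable_rieszKernel α).lintegral_prod_right', ← mul_assoc, sq]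

theorem rieszEnergy_le {α : ℝ} {A : Set (Space d)} {μ : Measure (Space d)} (h : μ A = 1) :
    rieszEnergy α A ≤ rieszInteraction α μ μ :=
  iInf₂_le μ h

/-- An admissible measure for `A`, restricted to `A`, is admissible for `B` and has no larger
energy. -/
theorem rieszEnergy_mono {α : ℝ} {A B : Set (Space d)} (hA : MeasurableSet A) (h : A ⊆ B) :
    rieszEnergy α B ≤ rieszEnergy α A := by
  refine le_iInf₂ fun μ hμ => ?_
  have h1 : μ.restrict A B = 1 := by
    rw [Measure.restrict_apply' hA, inter_eq_self_of_subset_right h]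
    exact hμ
  exact (rieszEnergy_le h1).trans (rieszInteraction_mono Measure.restrict_le_self)

/-- A set that carries at least the fraction `c` of a charge distribution. -/
theorem rieszEnergy_le_of_le_measure {α : ℝ} {A : Set (Space d)} {ν : Measure (Space d)}
    [IsFiniteMeasure ν] {c : ℝ≥0∞} (hc : c ≠ 0) (h : c ≤ ν A) :
    rieszEnergy α A ≤ (c⁻¹) ^ 2 * rieszInteraction α ν ν := by
  have h0 : ν A ≠ 0 := fun h' => hc (le_antisymm (h'.symm ▸ h) zero_le)
  have h1 : ((ν A)⁻¹ • ν) A = 1 := by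
    rw [Measure.smul_apply, smul_eq_mul, ENNReal.inv_mul_cancel h0 (measure_ne_top _ _)]
  refine (rieszEnergy_le h1).trans ?_
  rw [rieszInteraction_smul_smul]
  gcongr

/-! ### Uniformly charged balls and their interaction. -/

/-- The potential of a ball is bounded by its value for comparable distances. -/
theorem exists_potential_ball_le (hd : 1 ≤ d) {α : ℝ} (hα : 0 < α) (hαd : α < d) :
    ∃ C : ℝ≥0∞, C ≠ ⊤ ∧ ∀ (z x : Space d) (r : ℝ), 0 < r →
      ∫⁻ b in Metric.ball x r, edist z b ^ (-α)
        ≤ C * ENNReal.ofReal r ^ (-α) * volume (Metric.ball x r) := by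
  let c₀ : ℝ≥0∞ := ∫⁻ b in Metric.ball (0 : Space d) 1, ‖b‖ₑ ^ (-α)
  have hc₀ : c₀ ≠ ⊤ := by
    have hint : IntegrableOn (fun b : Space d => ‖b‖ ^ (-α)) (Metric.ball 0 1) := by
      refine integrableOn_ball_of_norm_le_rpow (C := 1) (α := α) (by simpa using hd)
        (by simpa using hαd) (Eventually.of_forall fun x => ?_) ?_
      · rw [one_mul, Real.norm_eq_abs, abs_of_nonneg (by positivity)]
      · exact (measurable_norm.pow_const _).aestronglyMeasurable
    have h1 := hint.2
    refine ne_of_lt (lt_of_le_of_lt (le_of_eq ?_) h1)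
    refine setLIntegral_congr_fun_ae measurableSet_ball ?_
    have hnull : ∀ᵐ b : Space d, b ≠ 0 := by
      have := nontrivial_space hd
      exact Measure.ae_ne volume 0
    filter_upwards [hnull] with b hb _
    rw [Real.enorm_eq_ofReal (by positivity), ← ofReal_norm,
      ENNReal.ofReal_rpow_of_pos (norm_pos_iff.2 hb)]
  let V : ℝ≥0∞ := volume (Metric.ball (0 : Space d) 1)
  have hV0 : V ≠ 0 := (Metric.measure_ball_pos volume _ one_pos).ne'
  have hVt : V ≠ ⊤ := measure_ball_lt_top.ne
  refine ⟨c₀ / V + 1, ENNReal.add_ne_top.2 ⟨ENNReal.div_ne_top hc₀ hV0, ENNReal.one_ne_top⟩,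
    fun z x r hr => ?_⟩
  have hvol : volume (Metric.ball x r) = ENNReal.ofReal (r ^ d) * V := by
    rw [Measure.addHaar_ball_of_pos _ _ hr, finrank_euclideanSpace_fin]
  let g : Space d → ℝ≥0∞ := (Metric.ball (0 : Space d) r).indicator fun b => ‖b‖ₑ ^ (-α)
  have hg : Measurable g := (measurable_enorm.pow_const _).indicator measurableSet_ball
  have hscale : ∫⁻ b, g b = ENNReal.ofReal (r ^ d) * (ENNReal.ofReal r ^ (-α) * c₀) := by
    have hmap := Measure.map_addHaar_smul (volume : Measure (Space d)) hr.ne'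
    rw [finrank_euclideanSpace_fin] at hmap
    have h1 : ∫⁻ b, g (r • b) = ENNReal.ofReal |(r ^ d)⁻¹| * ∫⁻ b, g b := by
      rw [← lintegral_map hg (measurable_const_smul r), hmap, lintegral_smul_measure, smul_eq_mul]
    have h2 : ∫⁻ b, g (r • b) = ENNReal.ofReal r ^ (-α) * c₀ := by
      simp only [c₀]
      rw [← lintegral_const_mul _ (measurable_enorm.pow_const _),
        ← lintegral_indicator measurableSet_ball]
      refine lintegral_congr fun b => ?_
      have hmem : r • b ∈ Metric.ball (0 : Space d) r ↔ b ∈ Metric.ball (0 : Space d) 1 := by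
        simp only [mem_ball_zero_iff, norm_smul, Real.norm_eq_abs, abs_of_pos hr]
        constructor
        · intro h; nlinarith
        · intro h; nlinarith
      by_cases hb : b ∈ Metric.ball (0 : Space d) 1
      · simp only [g, indicator_of_mem hb, indicator_of_mem (hmem.2 hb)]
        rw [enorm_smul, Real.enorm_eq_ofReal hr.le,
          ENNReal.mul_rpow_of_ne_top ENNReal.ofReal_ne_top enorm_ne_top]
      · simp only [g, indicator_of_notMem hb, indicator_of_notMem (mt hmem.1 hb)]
    rw [h2, abs_of_pos (by positivity)] at h1
    rw [h1, ← mul_assoc, ← ENNReal.ofReal_mul (by positivity),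
      mul_inv_cancel₀ (by positivity), ENNReal.ofReal_one, one_mul]
  have hshift : ∫⁻ b, g (b - z) = ∫⁻ b, g b := lintegral_sub_right_eq_self g z
  calc ∫⁻ b in Metric.ball x r, edist z b ^ (-α)
      = ∫⁻ b, (Metric.ball x r).indicator (fun b => edist z b ^ (-α)) b :=
        (lintegral_indicator measurableSet_ball _).symm
    -- Points of the ball within `r` of `z` are bounded by the potential of a ball centred at `z`,
    -- finite as `α < d`; at the others the kernel is at most `r ^ (-α)`.
    _ ≤ ∫⁻ b, (g (b - z)
          + (Metric.ball x r).indicator (fun _ => ENNReal.ofReal r ^ (-α)) b) := by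
        refine lintegral_mono fun b => ?_
        by_cases hb : b ∈ Metric.ball x r
        · rw [indicator_of_mem hb, indicator_of_mem hb]
          by_cases hz : b - z ∈ Metric.ball (0 : Space d) r
          · simp only [g, indicator_of_mem hz]
            rw [edist_comm, edist_eq_enorm_sub]
            exact le_self_add
          · refine le_add_left (rpow_neg_le_rpow_neg hα.le ?_)
            rw [edist_dist]
            refine ENNReal.ofReal_le_ofReal ?_
            rw [dist_comm, dist_eq_norm]
            simpa using hz
        · rw [indicator_of_notMem hb]; exact zero_le
    _ = ENNReal.ofReal (r ^ d) * (ENNReal.ofReal r ^ (-α) * c₀)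
          + ENNReal.ofReal r ^ (-α) * volume (Metric.ball x r) := by
        rw [lintegral_add_left (f := fun b => g (b - z)) (hg.comp (measurable_sub_const z)), hshift, hscale,
          lintegral_indicator_const measurableSet_ball]
    _ = (c₀ / V + 1) * ENNReal.ofReal r ^ (-α) * volume (Metric.ball x r) := by
        rw [hvol]
        have : c₀ = c₀ / V * V := (ENNReal.div_mul_cancel hV0 hVt).symm
        conv_lhs => rw [this]
        ring

/-- The uniform probability measure on a ball. -/
noncomputable def uniformBall (x : Space d) (r : ℝ) : Measure (Space d) :=
  (volume (Metric.ball x r))⁻¹ • volume.restrict (Metric.ball x r)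

theorem isProbabilityMeasure_uniformBall (x : Space d) {r : ℝ} (hr : 0 < r) :
    IsProbabilityMeasure (uniformBall x r) := by
  constructor
  rw [uniformBall, Measure.smul_apply, Measure.restrict_apply_univ, smul_eq_mul]
  exact ENNReal.inv_mul_cancel (Metric.measure_ball_pos volume _ hr).ne' measure_ball_lt_top.ne

instance (x : Space d) (r : ℝ) : SFinite (uniformBall x r) := by
  unfold uniformBall; infer_instance

theorem uniformBall_ball (x : Space d) {r : ℝ} (hr : 0 < r) :
    uniformBall x r (Metric.ball x r) = 1 := by
  rw [uniformBall, Measure.smul_apply, Measure.restrict_apply_self, smul_eq_mul]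
  exact ENNReal.inv_mul_cancel (Metric.measure_ball_pos volume _ hr).ne' measure_ball_lt_top.ne

theorem ae_uniformBall_mem (x : Space d) (r : ℝ) :
    ∀ᵐ a ∂uniformBall x r, a ∈ Metric.ball x r :=
  Measure.ae_smul_measure (ae_restrict_mem measurableSet_ball) _

/-- A pointwise bound for the interaction of two uniformly charged balls of radius `r`, where `C`
is the constant of the potential estimate. -/
noncomputable def ballKernel (α : ℝ) (C : ℝ≥0∞) (r : ℝ) (p : Space d × Space d) : ℝ≥0∞ :=
  if 4 * r ≤ dist p.1 p.2 then ENNReal.ofReal (dist p.1 p.2 - 2 * r) ^ (-α)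
  else C * ENNReal.ofReal r ^ (-α)

theorem measurable_ballKernel (α : ℝ) (C : ℝ≥0∞) (r : ℝ) :
    Measurable (ballKernel (d := d) α C r) := by
  refine Measurable.ite (measurableSet_le measurable_const measurable_dist) ?_ measurable_const
  exact ((measurable_dist.sub_const _).ennreal_ofReal).pow_const _

theorem rieszInteraction_uniformBall_le {α : ℝ} {C : ℝ≥0∞}
    (hC : ∀ (z x : Space d) (r : ℝ), 0 < r → ∫⁻ b in Metric.ball x r, edist z b ^ (-α)
      ≤ C * ENNReal.ofReal r ^ (-α) * volume (Metric.ball x r))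
    (x y : Space d) {r : ℝ} (hr : 0 < r) :
    rieszInteraction α (uniformBall x r) (uniformBall y r) ≤ C * ENNReal.ofReal r ^ (-α) := by
  have := isProbabilityMeasure_uniformBall x hr
  have hV0 : volume (Metric.ball y r) ≠ 0 := (Metric.measure_ball_pos volume _ hr).ne'
  have hVt : volume (Metric.ball y r) ≠ ⊤ := measure_ball_lt_top.ne
  calc rieszInteraction α (uniformBall x r) (uniformBall y r)
      ≤ ∫⁻ _, C * ENNReal.ofReal r ^ (-α) ∂uniformBall x r := by
        refine lintegral_mono fun a => ?_
        rw [uniformBall, lintegral_smul_measure, smul_eq_mul, mul_comm, ← div_eq_mul_inv,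
          ENNReal.div_le_iff hV0 hVt]
        exact hC a y r hr
    _ = _ := by simp

theorem rieszInteraction_uniformBall_le_ballKernel {α : ℝ} (hα : 0 ≤ α) {C : ℝ≥0∞}
    (hC : ∀ (z x : Space d) (r : ℝ), 0 < r → ∫⁻ b in Metric.ball x r, edist z b ^ (-α)
      ≤ C * ENNReal.ofReal r ^ (-α) * volume (Metric.ball x r))
    (x y : Space d) {r : ℝ} (hr : 0 < r) :
    rieszInteraction α (uniformBall x r) (uniformBall y r) ≤ ballKernel α C r (x, y) := by
  unfold ballKernel
  split_ifs with h
  · have := isProbabilityMeasure_uniformBall x hr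
    have := isProbabilityMeasure_uniformBall y hr
    have hpt : ∀ᵐ a ∂uniformBall x r, ∀ᵐ b ∂uniformBall y r,
        edist a b ^ (-α) ≤ ENNReal.ofReal (dist x y - 2 * r) ^ (-α) := by
      filter_upwards [ae_uniformBall_mem x r] with a ha
      filter_upwards [ae_uniformBall_mem y r] with b hb
      refine rpow_neg_le_rpow_neg hα ?_
      rw [edist_dist]
      refine ENNReal.ofReal_le_ofReal ?_
      have h1 := dist_triangle4 x a b y
      rw [dist_comm x a] at h1
      linarith [Metric.mem_ball.1 ha, Metric.mem_ball.1 hb]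
    calc rieszInteraction α (uniformBall x r) (uniformBall y r)
        ≤ ∫⁻ _, ∫⁻ _, ENNReal.ofReal (dist x y - 2 * r) ^ (-α) ∂uniformBall y r
            ∂uniformBall x r := by
          refine lintegral_mono_ae ?_
          filter_upwards [hpt] with a ha using lintegral_mono_ae ha
      _ = _ := by simp
  · exact rieszInteraction_uniformBall_le hC x y hr

/-- This bound, uniform in `r`, is the domination for the limit `r → 0`. For distance at least `4 *
r`, subtracting `2 * r` at most halves it; otherwise `r` exceeds a quarter of the distance. -/
theorem ballKernel_le {α : ℝ} (hα : 0 ≤ α) (C : ℝ≥0∞) (r : ℝ)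
    (p : Space d × Space d) :
    ballKernel α C r p ≤ (2 ^ α + C * 4 ^ α) * edist p.1 p.2 ^ (-α) := by
  unfold ballKernel
  rw [add_mul]
  split_ifs with h
  · refine le_add_right (rpow_neg_le_of_le_mul hα two_ne_zero ENNReal.ofNat_ne_top ?_)
    rw [edist_dist, show (2 : ℝ≥0∞) * _ = ENNReal.ofReal 2 * _ by rw [ENNReal.ofReal_ofNat],
      ← ENNReal.ofReal_mul (by norm_num)]
    exact ENNReal.ofReal_le_ofReal (by linarith)
  · refine le_add_left ?_
    rw [mul_assoc]
    gcongr
    refine rpow_neg_le_of_le_mul hα four_ne_zero ENNReal.ofNat_ne_top ?_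
    rw [edist_dist, show (4 : ℝ≥0∞) * _ = ENNReal.ofReal 4 * _ by rw [ENNReal.ofReal_ofNat],
      ← ENNReal.ofReal_mul (by norm_num)]
    exact ENNReal.ofReal_le_ofReal (by linarith)

theorem tendsto_ballKernel (α : ℝ) (C : ℝ≥0∞) {p : Space d × Space d} (hp : p.1 ≠ p.2) :
    Tendsto (fun r => ballKernel α C r p) (𝓝 0) (𝓝 (edist p.1 p.2 ^ (-α))) := by
  have hpos : 0 < dist p.1 p.2 := dist_pos.2 hp
  have h1 : Tendsto (fun r : ℝ => ENNReal.ofReal (dist p.1 p.2 - 2 * r) ^ (-α)) (𝓝 0)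
      (𝓝 (ENNReal.ofReal (dist p.1 p.2) ^ (-α))) := by
    refine (ENNReal.continuous_rpow_const.tendsto _).comp
      ((ENNReal.continuous_ofReal.tendsto _).comp ?_)
    exact Continuous.tendsto' (by fun_prop) _ _ (by simp)
  rw [edist_dist]
  refine h1.congr' ?_
  have h2 : ∀ᶠ r : ℝ in 𝓝 0, 4 * r < dist p.1 p.2 :=
    ContinuousAt.eventually_lt (by fun_prop) continuousAt_const (by simpa using hpos)
  filter_upwards [h2] with r hr
  rw [ballKernel, if_pos hr.le]

theorem rieszInteraction_eq_lintegral_prod (α : ℝ) (μ ν : Measure (Space d)) [SFinite ν] :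
    rieszInteraction α μ ν = ∫⁻ p, edist p.1 p.2 ^ (-α) ∂(μ.prod ν) :=
  (lintegral_prod _ (measurable_rieszKernel α).aemeasurable).symm

theorem tendsto_lintegral_ballKernel {α : ℝ} (hα : 0 < α) {C : ℝ≥0∞} (hC : C ≠ ⊤)
    (μ : Measure (Space d)) [IsProbabilityMeasure μ] (hμ : rieszInteraction α μ μ ≠ ⊤) :
    Tendsto (fun r => ∫⁻ p, ballKernel α C r p ∂(μ.prod μ)) (𝓝[>] 0)
      (𝓝 (rieszInteraction α μ μ)) := by
  rw [rieszInteraction_eq_lintegral_prod] at hμ ⊢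
  refine tendsto_lintegral_filter_of_dominated_convergence
    (fun p => (2 ^ α + C * 4 ^ α) * edist p.1 p.2 ^ (-α))
    (Eventually.of_forall fun r => measurable_ballKernel α C r) ?_ ?_ ?_
  · exact Eventually.of_forall fun r => Eventually.of_forall fun p => ballKernel_le hα.le C r p
  · rw [lintegral_const_mul _ (measurable_rieszKernel α)]
    refine ENNReal.mul_ne_top (ENNReal.add_ne_top.2 ⟨?_, ENNReal.mul_ne_top hC ?_⟩) hμ
    · exact ENNReal.rpow_ne_top_of_nonneg hα.le ENNReal.ofNat_ne_top
    · exact ENNReal.rpow_ne_top_of_nonneg hα.le ENNReal.ofNat_ne_top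
  · filter_upwards [ae_lt_top (measurable_rieszKernel α) hμ] with p hp
    refine (tendsto_ballKernel α C fun h => ?_).mono_left nhdsWithin_le_nhds
    rw [h, edist_self, ENNReal.zero_rpow_of_neg (by linarith)] at hp
    exact lt_irrefl _ hp

/-! ### Sampling a charge and replacing it by charged balls. -/

/-- Among independent samples of a probability measure there is one whose pair energy does not
exceed its mean. -/
theorem exists_points_sum_le {X : Type*} [MeasurableSpace X] (μ : Measure X)
    [IsProbabilityMeasure μ] {K : Set X} (hK : μ Kᶜ = 0) {h : X × X → ℝ≥0∞} (hh : Measurable h)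
    (N : ℕ) : ∃ x : Fin N → X, (∀ i, x i ∈ K) ∧
      ∑ i, ∑ j ∈ Finset.univ.erase i, h (x i, x j) ≤ (N : ℝ≥0∞) ^ 2 * ∫⁻ p, h p ∂(μ.prod μ) := by
  let P : Measure (Fin N → X) := Measure.pi fun _ => μ
  have hmap : ∀ i, P.map (fun y => y i) = μ := fun i =>
    (measurePreserving_eval (fun _ : Fin N => μ) i).map_eq
  have hnull : P (⋃ i, (fun y => y i) ⁻¹' Kᶜ) = 0 := by
    refine measure_iUnion_null fun i => ?_
    exact (measurePreserving_eval (fun _ : Fin N => μ) i).quasiMeasurePreserving.preimage_null hK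
  have hmeas : ∀ i j : Fin N, Measurable fun y : Fin N → X => h (y i, y j) := fun i j =>
    hh.comp ((measurable_pi_apply i).prodMk (measurable_pi_apply j))
  -- Distinct coordinates are independent, so each off-diagonal term has mean equal to the integral
  -- against `μ.prod μ`.
  have hind : ∀ i j : Fin N, i ≠ j → ∫⁻ y, h (y i, y j) ∂P = ∫⁻ p, h p ∂(μ.prod μ) := by
    intro i j hij
    have h1 := (ProbabilityTheory.iIndepFun_pi (μ := fun _ : Fin N => μ) (X := fun _ x => x)
      fun i => aemeasurable_id).indepFun hij
    have h2 := h1.map_prod_eq_prod_map_map (measurable_pi_apply i).aemeasurable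
      (measurable_pi_apply j).aemeasurable
    change P.map (fun y => (y i, y j)) = (P.map fun y => y i).prod (P.map fun y => y j) at h2
    rw [hmap, hmap] at h2
    rw [← h2, lintegral_map hh ((measurable_pi_apply i).prodMk (measurable_pi_apply j))]
  obtain ⟨x, hx, hle⟩ := exists_notMem_null_le_lintegral (μ := P)
    (f := fun y => ∑ i, ∑ j ∈ Finset.univ.erase i, h (y i, y j))
    (Finset.measurable_fun_sum _ fun i _ => Finset.measurable_fun_sum _ fun j _ =>
      hmeas i j).aemeasurable hnull
  refine ⟨x, fun i => ?_, hle.trans ?_⟩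
  · by_contra hi
    exact hx (mem_iUnion.2 ⟨i, hi⟩)
  · rw [lintegral_finsetSum _ fun i _ => Finset.measurable_fun_sum _ fun j _ => hmeas i j]
    calc ∑ i, ∫⁻ y, ∑ j ∈ Finset.univ.erase i, h (y i, y j) ∂P
        ≤ ∑ _i : Fin N, (N : ℝ≥0∞) * ∫⁻ p, h p ∂(μ.prod μ) := by
          refine Finset.sum_le_sum fun i _ => ?_
          rw [lintegral_finsetSum _ fun j _ => hmeas i j,
            Finset.sum_congr rfl fun j hj => hind i j (Finset.ne_of_mem_erase hj).symm,
            Finset.sum_const, nsmul_eq_mul]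
          gcongr
          simp
      _ = _ := by
          rw [Finset.sum_const, nsmul_eq_mul, Finset.card_univ, Fintype.card_fin, sq, mul_assoc]

theorem rieszInteraction_sum_sum {ι : Type*} [Fintype ι] (α : ℝ)
    (μ : ι → Measure (Space d)) [∀ i, SFinite (μ i)] :
    rieszInteraction α (∑ i, μ i) (∑ i, μ i) = ∑ i, ∑ j, rieszInteraction α (μ i) (μ j) := by
  simp only [rieszInteraction, lintegral_finsetSum_measure]
  refine Finset.sum_congr rfl fun i _ => ?_
  rw [lintegral_finsetSum]
  exact fun j _ => (measurable_rieszKernel α).lintegral_prod_right'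

theorem tendsto_const_mul_ofReal_rpow {c : ℝ≥0∞} (hc : c ≠ ⊤) {s : ℝ} (hs : 0 < s) :
    Tendsto (fun r : ℝ => c * ENNReal.ofReal (r ^ s)) (𝓝[>] 0) (𝓝 0) := by
  have h1 : Tendsto (fun r : ℝ => r ^ s) (𝓝 0) (𝓝 0) :=
    (Real.continuousAt_rpow_const 0 s (Or.inr hs.le)).tendsto.trans (by
      rw [Real.zero_rpow hs.ne'])
  have h2 := (ENNReal.continuous_ofReal.tendsto _).comp h1
  rw [ENNReal.ofReal_zero] at h2
  have h3 := ENNReal.Tendsto.const_mul h2 (Or.inr hc)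
  rw [mul_zero] at h3
  exact h3.mono_left nhdsWithin_le_nhds

/-- Near-optimal charges may be moved to a compact subset of the interior. -/
theorem HasSmoothBoundary.exists_interior_charge {Ω : Set (Space d)} (hΩ : HasSmoothBoundary Ω)
    (hc : IsCompact Ω) {α : ℝ} (hα : 0 < α) (hI : rieszEnergy α Ω ≠ ⊤) {η : ℝ≥0∞} (hη : η ≠ 0)
    (hηt : η ≠ ⊤) :
    ∃ (μ : Measure (Space d)) (K : Set (Space d)), IsProbabilityMeasure μ ∧ IsCompact K ∧
      K ⊆ interior Ω ∧ μ Kᶜ = 0 ∧ rieszInteraction α μ μ ≤ rieszEnergy α Ω + η := by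
  have hη2 : η / 2 ≠ 0 := (ENNReal.half_pos hη).ne'
  have hη2t : η / 2 ≠ ⊤ := ENNReal.div_ne_top hηt two_ne_zero
  obtain ⟨μ₀, hμ₀⟩ := iInf_lt_iff.1 (ENNReal.lt_add_right hI hη2)
  obtain ⟨hμ₀Ω, hμ₀I⟩ := iInf_lt_iff.1 hμ₀
  have hμ₀Ω : μ₀ Ω = 1 := hμ₀Ω
  let e : ℝ≥0∞ := rieszEnergy α Ω + η / 2
  have het : e ≠ ⊤ := ENNReal.add_ne_top.2 ⟨hI, hη2t⟩
  obtain ⟨θ, hθ0, hθ1, hθ⟩ : ∃ θ : ℝ≥0, 0 < θ ∧ θ < 1 ∧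
      ((1 + θ : ℝ≥0) : ℝ≥0∞) ^ α * e < rieszEnergy α Ω + η := by
    have h1 : Tendsto (fun θ : ℝ≥0 => ((1 + θ : ℝ≥0) : ℝ≥0∞) ^ α) (𝓝 0) (𝓝 1) := by
      have h : Continuous fun θ : ℝ≥0 => ((1 + θ : ℝ≥0) : ℝ≥0∞) ^ α :=
        ENNReal.continuous_rpow_const.comp
          (ENNReal.continuous_coe.comp (continuous_const.add continuous_id))
      exact h.tendsto' _ _ (by simp)
    have h2 := ENNReal.Tendsto.mul_const h1 (b := e) (Or.inr het)
    rw [one_mul] at h2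
    have hlt : e < rieszEnergy α Ω + η :=
      ENNReal.add_lt_add_left hI (ENNReal.half_lt_self hη hηt)
    have h3 := h2.eventually (gt_mem_nhds hlt)
    have h4 : ∀ᶠ θ : ℝ≥0 in 𝓝 0, θ < 1 := gt_mem_nhds one_pos
    obtain ⟨θ, ⟨h5, h6⟩, h7⟩ := ((h3.and h4).filter_mono
      (nhdsWithin_le_nhds (s := Ioi 0))).and self_mem_nhdsWithin |>.exists
    exact ⟨θ, h7, h6, h5⟩
  -- The charge is pushed forward by the inverse of `Ψ`. As `Ψ` is `(1 + θ)`-Lipschitz, distances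
  -- shrink by at most that factor and the energy grows at most by `(1 + θ) ^ α`.
  obtain ⟨Ψ, -, hΨlip, -, -, hΨΩ⟩ := hΩ.exists_homeomorph hc hθ0 hθ1
  let μ₁ := μ₀.restrict Ω
  have hμ₁ : IsProbabilityMeasure μ₁ := ⟨by rw [Measure.restrict_apply_univ, hμ₀Ω]⟩
  have hΦm : Measurable Ψ.symm := Ψ.symm.continuous.measurable
  let μ := μ₁.map Ψ.symm
  have hμ : IsProbabilityMeasure μ := Measure.isProbabilityMeasure_map hΦm.aemeasurable
  refine ⟨μ, Ψ.symm '' Ω, hμ, hc.image Ψ.symm.continuous, ?_, ?_, ?_⟩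
  · rintro _ ⟨x, hx, rfl⟩
    by_contra h
    have := hΨΩ _ h
    rw [Ψ.apply_symm_apply] at this
    exact this hx
  · have hKm : MeasurableSet (Ψ.symm '' Ω)ᶜ :=
      (hc.image Ψ.symm.continuous).measurableSet.compl
    rw [Measure.map_apply hΦm hKm, Measure.restrict_apply (hΦm hKm)]
    convert measure_empty (μ := μ₀)
    ext x
    simp only [mem_inter_iff, mem_preimage, mem_compl_iff, mem_empty_iff_false, iff_false, not_and]
    intro h hx
    exact h ⟨x, hx, rfl⟩
  · have hker : ∀ x y : Space d, edist (Ψ.symm x) (Ψ.symm y) ^ (-α)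
        ≤ ((1 + θ : ℝ≥0) : ℝ≥0∞) ^ α * edist x y ^ (-α) := by
      intro x y
      refine rpow_neg_le_of_le_mul hα.le (by simp) ENNReal.coe_ne_top ?_
      simpa using hΨlip (Ψ.symm x) (Ψ.symm y)
    calc rieszInteraction α μ μ
        = ∫⁻ x, ∫⁻ y, edist (Ψ.symm x) (Ψ.symm y) ^ (-α) ∂μ₁ ∂μ₁ := by
          rw [rieszInteraction, lintegral_map (measurable_rieszKernel α).lintegral_prod_right' hΦm]
          refine lintegral_congr fun x => ?_
          exact lintegral_map (measurable_rieszKernel_right α _) hΦm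
      _ ≤ ∫⁻ x, ∫⁻ y, ((1 + θ : ℝ≥0) : ℝ≥0∞) ^ α * edist x y ^ (-α) ∂μ₁ ∂μ₁ :=
          lintegral_mono fun x => lintegral_mono fun y => hker x y
      _ = ((1 + θ : ℝ≥0) : ℝ≥0∞) ^ α * rieszInteraction α μ₁ μ₁ := by
          have h : ∀ x : Space d, ∫⁻ y, ((1 + θ : ℝ≥0) : ℝ≥0∞) ^ α * edist x y ^ (-α) ∂μ₁
              = ((1 + θ : ℝ≥0) : ℝ≥0∞) ^ α * ∫⁻ y, edist x y ^ (-α) ∂μ₁ := fun x =>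
            lintegral_const_mul _ (measurable_rieszKernel_right α x)
          simp only [h]
          rw [lintegral_const_mul _ (measurable_rieszKernel α).lintegral_prod_right']
          rfl
      _ ≤ ((1 + θ : ℝ≥0) : ℝ≥0∞) ^ α * e := by
          gcongr
          exact (rieszInteraction_mono Measure.restrict_le_self).trans hμ₀I.le
      _ ≤ _ := hθ.le

/-- Charging finitely many tiny balls uniformly: the energy is nearly that of `Ω`, while volume
and perimeter of the union of the balls are negligible. -/
theorem HasSmoothBoundary.exists_charged_balls (hd : 2 ≤ d) {Ω : Set (Space d)}
    (hΩ : HasSmoothBoundary Ω) (hc : IsCompact Ω) {α : ℝ} (hα : 0 < α) (hαd : α < (d : ℝ) - 1)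
    (hI : rieszEnergy α Ω ≠ ⊤) {η : ℝ≥0∞} (hη : η ≠ 0) (hηt : η ≠ ⊤) :
    ∃ (C C' : Set (Space d)) (ν : Measure (Space d)) (c : ℝ≥0∞), IsOpen C ∧ IsClosed C' ∧
      C ⊆ C' ∧ C' ⊆ Ω ∧ volume C' ≤ η ∧ perimeter C ≤ η ∧ perimeter C' ≤ η ∧
      IsProbabilityMeasure ν ∧ ν C = 1 ∧ c ≠ ⊤ ∧ (∀ s, ν s ≤ c * volume s) ∧
      rieszInteraction α ν ν ≤ rieszEnergy α Ω + η := by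
  have hη3 : η / 3 ≠ 0 := ENNReal.div_ne_zero.2 ⟨hη, ENNReal.ofNat_ne_top⟩
  have hη3t : η / 3 ≠ ⊤ := ENNReal.div_ne_top hηt three_ne_zero
  obtain ⟨μ, K, hμ, hK, hKΩ, hμK, hμI⟩ := hΩ.exists_interior_charge hc hα hI hη3 hη3t
  have hμt : rieszInteraction α μ μ ≠ ⊤ :=
    (hμI.trans_lt (ENNReal.add_lt_top.2 ⟨hI.lt_top, hη3t.lt_top⟩)).ne
  obtain ⟨M, hMt, hM⟩ := exists_potential_ball_le (d := d) (by omega) hα (by linarith)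
  let V : ℝ≥0∞ := volume (Metric.ball (0 : Space d) 1)
  have hVt : V ≠ ⊤ := measure_ball_lt_top.ne
  -- The midpoint of `(α, d - 1)`: with `N ≈ r ^ (-p)` balls, `p < d - 1` makes the total perimeter
  -- vanish and `p > α` the total self-energy.
  let p : ℝ := (α + (d - 1)) / 2
  have hp1 : 0 < p - α := by simp only [p]; linarith
  have hp2 : 0 < (d : ℝ) - 1 - p := by simp only [p]; linarith
  obtain ⟨δ, hδ, hδΩ⟩ := hK.exists_cthickening_subset_open isOpen_interior hKΩ
  have e1 := (tendsto_lintegral_ballKernel hα hMt μ hμt).eventually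
    (gt_mem_nhds (ENNReal.lt_add_right hμt hη3))
  have e2 : ∀ᶠ r : ℝ in 𝓝[>] 0, r ≤ 1 :=
    nhdsWithin_le_nhds (eventually_le_nhds one_pos)
  have e3 : ∀ᶠ r : ℝ in 𝓝[>] 0, r ≤ δ := nhdsWithin_le_nhds (eventually_le_nhds hδ)
  have e4 := (tendsto_const_mul_ofReal_rpow (c := 2 * d * V) (by
    exact ENNReal.mul_ne_top (ENNReal.mul_ne_top ENNReal.ofNat_ne_top (ENNReal.natCast_ne_top d))
      hVt) hp2).eventually (gt_mem_nhds (pos_iff_ne_zero.2 hη))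
  have e5 := (tendsto_const_mul_ofReal_rpow hMt hp1).eventually
    (gt_mem_nhds (pos_iff_ne_zero.2 hη3))
  obtain ⟨r, ⟨⟨⟨⟨hr1, hr2⟩, hr3⟩, hr4⟩, hr5⟩, hr0⟩ :=
    ((((e1.and e2).and e3).and e4).and e5).and self_mem_nhdsWithin |>.exists
  have hr0 : 0 < r := hr0
  let N : ℕ := ⌈r ^ (-p)⌉₊
  have hrp1 : 1 ≤ r ^ (-p) :=
    Real.one_le_rpow_of_pos_of_le_one_of_nonpos hr0 hr2 (by linarith)
  have hN1 : r ^ (-p) ≤ N := Nat.le_ceil _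
  have hN2 : (N : ℝ) ≤ 2 * r ^ (-p) := by
    have := Nat.ceil_lt_add_one (a := r ^ (-p)) (by positivity)
    linarith
  have hN0 : (0 : ℝ) < N := by linarith
  have hN0' : (N : ℝ≥0∞) ≠ 0 := by
    have : N ≠ 0 := by intro h; rw [h] at hN0; simp at hN0
    exact_mod_cast this
  have hNt : (N : ℝ≥0∞) ≠ ⊤ := ENNReal.natCast_ne_top N
  have hrd : r ^ (d - 1) = r ^ ((d : ℝ) - 1) := by
    rw [← Real.rpow_natCast, Nat.cast_sub (by omega), Nat.cast_one]
  have hNr : (N : ℝ) * r ^ (d - 1) ≤ 2 * r ^ ((d : ℝ) - 1 - p) := by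
    calc (N : ℝ) * r ^ (d - 1) ≤ 2 * r ^ (-p) * r ^ (d - 1) := by gcongr
      _ = 2 * r ^ ((d : ℝ) - 1 - p) := by
        rw [hrd, mul_assoc, ← Real.rpow_add hr0]; congr 2; ring
  obtain ⟨x, hxK, hxsum⟩ := exists_points_sum_le μ hμK (measurable_ballKernel α M r) N
  have hper : ∑ i : Fin N, perimeter (Metric.ball (x i) r) ≤ η := by
    calc ∑ i : Fin N, perimeter (Metric.ball (x i) r)
        ≤ ∑ _i : Fin N, ENNReal.ofReal (d * r ^ (d - 1)) * V :=
          Finset.sum_le_sum fun i _ => perimeter_ball_le (x i) hr0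
      _ = ENNReal.ofReal (d * (N * r ^ (d - 1))) * V := by
          rw [Finset.sum_const, nsmul_eq_mul, Finset.card_univ, Fintype.card_fin, ← mul_assoc,
            ← ENNReal.ofReal_natCast N, ← ENNReal.ofReal_mul (by positivity)]
          congr 2; ring
      _ ≤ ENNReal.ofReal (d * (2 * r ^ ((d : ℝ) - 1 - p))) * V := by gcongr
      _ = 2 * d * V * ENNReal.ofReal (r ^ ((d : ℝ) - 1 - p)) := by
          rw [ENNReal.ofReal_mul (by positivity), ENNReal.ofReal_mul (by positivity),
            ENNReal.ofReal_natCast, ENNReal.ofReal_ofNat]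
          ring
      _ ≤ η := hr4.le
  have hvol : ∑ i : Fin N, volume (Metric.closedBall (x i) r) ≤ η := by
    calc ∑ i : Fin N, volume (Metric.closedBall (x i) r)
        = ∑ _i : Fin N, ENNReal.ofReal (r ^ d) * V := by
          refine Finset.sum_congr rfl fun i _ => ?_
          rw [Measure.addHaar_closedBall _ _ hr0.le, finrank_euclideanSpace_fin]
      _ = ENNReal.ofReal (N * r ^ d) * V := by
          rw [Finset.sum_const, nsmul_eq_mul, Finset.card_univ, Fintype.card_fin, ← mul_assoc,
            ← ENNReal.ofReal_natCast N, ← ENNReal.ofReal_mul (by positivity)]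
      _ ≤ ENNReal.ofReal (d * (2 * r ^ ((d : ℝ) - 1 - p))) * V := by
          gcongr ENNReal.ofReal ?_ * V
          have h1 : r ^ d ≤ r ^ (d - 1) := pow_le_pow_of_le_one hr0.le hr2 (by omega)
          have h2 : (1 : ℝ) ≤ d := by exact_mod_cast (by omega : 1 ≤ d)
          calc (N : ℝ) * r ^ d ≤ N * r ^ (d - 1) := by gcongr
            _ ≤ 2 * r ^ ((d : ℝ) - 1 - p) := hNr
            _ ≤ d * (2 * r ^ ((d : ℝ) - 1 - p)) := le_mul_of_one_le_left (by positivity) h2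
      _ = 2 * d * V * ENNReal.ofReal (r ^ ((d : ℝ) - 1 - p)) := by
          rw [ENNReal.ofReal_mul (by positivity), ENNReal.ofReal_mul (by positivity),
            ENNReal.ofReal_natCast, ENNReal.ofReal_ofNat]
          ring
      _ ≤ η := hr4.le
  let ν : Measure (Space d) := (N : ℝ≥0∞)⁻¹ • ∑ i, uniformBall (x i) r
  have hνapp : ∀ s, ν s = (N : ℝ≥0∞)⁻¹ * ∑ i, uniformBall (x i) r s := fun s => by
    simp only [ν, Measure.smul_apply, Measure.finsetSum_apply, smul_eq_mul]
  have hνone : ∀ s, (∀ i, uniformBall (x i) r s = 1) → ν s = 1 := fun s hs => by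
    rw [hνapp, Finset.sum_congr rfl fun i _ => hs i, Finset.sum_const, nsmul_eq_mul, mul_one,
      Finset.card_univ, Fintype.card_fin, ENNReal.inv_mul_cancel hN0' hNt]
  have hprob : ∀ i, IsProbabilityMeasure (uniformBall (x i) r) := fun i =>
    isProbabilityMeasure_uniformBall (x i) hr0
  have hball : ∀ i, Metric.closedBall (x i) r ⊆ Ω := fun i =>
    ((Metric.closedBall_subset_cthickening (hxK i) r).trans
      ((Metric.cthickening_mono hr3 K).trans hδΩ)).trans interior_subset
  refine ⟨⋃ i, Metric.ball (x i) r, ⋃ i, Metric.closedBall (x i) r, ν,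
    (volume (Metric.ball (0 : Space d) r))⁻¹, isOpen_iUnion fun i => Metric.isOpen_ball,
    isClosed_iUnion_of_finite fun i => Metric.isClosed_closedBall,
    iUnion_mono fun i => Metric.ball_subset_closedBall, iUnion_subset hball, ?_, ?_, ?_, ?_, ?_,
    ?_, ?_, ?_⟩
  · exact (measure_iUnion_fintype_le _ _).trans hvol
  · have := perimeter_biUnion_finset_le Finset.univ (A := fun i : Fin N => Metric.ball (x i) r)
      (fun i => measurableSet_ball) (fun i => Metric.isBounded_ball)
    simp only [Finset.mem_univ, iUnion_true] at this
    exact this.trans hper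
  · have := perimeter_biUnion_finset_le Finset.univ
      (A := fun i : Fin N => Metric.closedBall (x i) r)
      (fun i => measurableSet_closedBall) (fun i => Metric.isBounded_closedBall)
    simp only [Finset.mem_univ, iUnion_true,
      perimeter_congr (closedBall_ae_eq_ball _ hr0.ne')] at this
    exact this.trans hper
  · exact ⟨hνone _ fun i => measure_univ⟩
  · refine hνone _ fun i => le_antisymm prob_le_one ?_
    rw [← uniformBall_ball (x i) hr0]
    exact measure_mono (subset_iUnion (fun i => Metric.ball (x i) r) i)
  · exact ENNReal.inv_ne_top.2 (Metric.measure_ball_pos volume _ hr0).ne'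
  · intro s
    rw [hνapp]
    calc (N : ℝ≥0∞)⁻¹ * ∑ i, uniformBall (x i) r s
        ≤ (N : ℝ≥0∞)⁻¹ * ∑ _i : Fin N, (volume (Metric.ball (0 : Space d) r))⁻¹ * volume s := by
          gcongr with i
          rw [uniformBall, Measure.smul_apply, smul_eq_mul, Measure.addHaar_ball_center]
          gcongr
          exact Measure.restrict_le_self
      _ = _ := by
          rw [Finset.sum_const, nsmul_eq_mul, Finset.card_univ, Fintype.card_fin, ← mul_assoc,
            ENNReal.inv_mul_cancel hN0' hNt, one_mul]
  · have hself : ∀ i, rieszInteraction α (uniformBall (x i) r) (uniformBall (x i) r)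
        ≤ M * ENNReal.ofReal r ^ (-α) := fun i => rieszInteraction_uniformBall_le hM _ _ hr0
    have hpair : ∀ i j, rieszInteraction α (uniformBall (x i) r) (uniformBall (x j) r)
        ≤ ballKernel α M r (x i, x j) := fun i j =>
      rieszInteraction_uniformBall_le_ballKernel hα.le hM _ _ hr0
    have hsum : ∑ i, ∑ j, rieszInteraction α (uniformBall (x i) r) (uniformBall (x j) r)
        ≤ N * (M * ENNReal.ofReal r ^ (-α))
          + (N : ℝ≥0∞) ^ 2 * ∫⁻ p, ballKernel α M r p ∂(μ.prod μ) := by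
      calc ∑ i, ∑ j, rieszInteraction α (uniformBall (x i) r) (uniformBall (x j) r)
          ≤ ∑ i : Fin N, (M * ENNReal.ofReal r ^ (-α)
              + ∑ j ∈ Finset.univ.erase i, ballKernel α M r (x i, x j)) := by
            refine Finset.sum_le_sum fun i _ => ?_
            rw [← Finset.add_sum_erase _ _ (Finset.mem_univ i)]
            exact add_le_add (hself i) (Finset.sum_le_sum fun j _ => hpair i j)
        _ = N * (M * ENNReal.ofReal r ^ (-α))
              + ∑ i, ∑ j ∈ Finset.univ.erase i, ballKernel α M r (x i, x j) := by
            rw [Finset.sum_add_distrib, Finset.sum_const, nsmul_eq_mul, Finset.card_univ,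
              Fintype.card_fin]
        _ ≤ _ := by gcongr
    have hNinv : (N : ℝ≥0∞)⁻¹ * ENNReal.ofReal r ^ (-α) ≤ ENNReal.ofReal (r ^ (p - α)) := by
      rw [← ENNReal.ofReal_natCast, ← ENNReal.ofReal_inv_of_pos hN0,
        ENNReal.ofReal_rpow_of_pos hr0, ← ENNReal.ofReal_mul (by positivity)]
      refine ENNReal.ofReal_le_ofReal ?_
      rw [sub_eq_add_neg, Real.rpow_add hr0]
      gcongr
      rw [inv_le_comm₀ hN0 (by positivity), ← Real.rpow_neg hr0.le]
      exact hN1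
    rw [rieszInteraction_smul_smul, rieszInteraction_sum_sum]
    calc ((N : ℝ≥0∞)⁻¹) ^ 2
          * ∑ i, ∑ j, rieszInteraction α (uniformBall (x i) r) (uniformBall (x j) r)
        ≤ ((N : ℝ≥0∞)⁻¹) ^ 2 * (N * (M * ENNReal.ofReal r ^ (-α))
          + (N : ℝ≥0∞) ^ 2 * ∫⁻ p, ballKernel α M r p ∂(μ.prod μ)) := by gcongr
      _ = ((N : ℝ≥0∞)⁻¹ * N) * (M * ((N : ℝ≥0∞)⁻¹ * ENNReal.ofReal r ^ (-α)))
          + ((N : ℝ≥0∞)⁻¹ * N) ^ 2 * ∫⁻ p, ballKernel α M r p ∂(μ.prod μ) := by ring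
      _ = M * ((N : ℝ≥0∞)⁻¹ * ENNReal.ofReal r ^ (-α))
          + ∫⁻ p, ballKernel α M r p ∂(μ.prod μ) := by
          rw [ENNReal.inv_mul_cancel hN0' hNt, one_mul, one_pow, one_mul]
      _ ≤ M * ENNReal.ofReal (r ^ (p - α)) + (rieszInteraction α μ μ + η / 3) := by
          gcongr
      _ ≤ η / 3 + ((rieszEnergy α Ω + η / 3) + η / 3) := by gcongr
      _ = rieszEnergy α Ω + (η / 3 + η / 3 + η / 3) := by ring
      _ = rieszEnergy α Ω + η := by rw [ENNReal.add_thirds]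

/-! ### Dense sets of small perimeter and competitors of prescribed volume. -/

/-- Here `d ≥ 2` is essential: it makes `r ^ (d - 1)` tend to zero. -/
theorem eventually_ball_small (hd : 2 ≤ d) {ε : ℝ≥0∞} (hε : ε ≠ 0) :
    ∀ᶠ r : ℝ in 𝓝[>] 0, ∀ x : Space d,
      perimeter (Metric.ball x r) ≤ ε ∧ volume (Metric.ball x r) ≤ ε := by
  let V : ℝ≥0∞ := volume (Metric.ball (0 : Space d) 1)
  have hVt : V ≠ ⊤ := measure_ball_lt_top.ne
  have key : ∀ f : ℝ → ℝ, Continuous f → f 0 = 0 →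
      ∀ᶠ r : ℝ in 𝓝[>] 0, ENNReal.ofReal (f r) * V < ε := by
    intro f hf h0
    have h1 : Tendsto (fun r : ℝ => ENNReal.ofReal (f r) * V) (𝓝 0) (𝓝 (ENNReal.ofReal 0 * V)) := by
      refine ENNReal.Tendsto.mul_const ((ENNReal.continuous_ofReal.tendsto _).comp ?_)
        (Or.inr hVt)
      exact hf.tendsto' 0 0 h0
    rw [ENNReal.ofReal_zero, zero_mul] at h1
    exact nhdsWithin_le_nhds (h1.eventually (gt_mem_nhds (pos_iff_ne_zero.2 hε)))
  have hd1 : d - 1 ≠ 0 := by omega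
  have hd0 : d ≠ 0 := by omega
  filter_upwards [key (fun r => d * r ^ (d - 1)) (by fun_prop) (by simp [hd1]),
    key (fun r => r ^ d) (by fun_prop) (by simp [hd0]), self_mem_nhdsWithin] with r h1 h2 hr x
  refine ⟨(perimeter_ball_le x hr).trans h1.le, ?_⟩
  rw [Measure.addHaar_ball_of_pos _ _ hr, finrank_euclideanSpace_fin]
  exact h2.le

/-- An open set contains an open dense subset of arbitrarily small perimeter and volume. -/
theorem exists_dense_open_small (hd : 2 ≤ d) {C : Set (Space d)} (hC : IsOpen C) {ε : ℝ≥0∞}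
    (hε : ε ≠ 0) :
    ∃ D, IsOpen D ∧ D ⊆ C ∧ C ⊆ closure D ∧ perimeter D ≤ ε ∧ volume D ≤ ε := by
  obtain ⟨e, he, hesum⟩ := ENNReal.exists_pos_sum_of_countable hε ℕ
  -- A tiny ball is put around each point of a dense sequence that falls in `C`, with summable
  -- bounds on perimeter and volume.
  let q := TopologicalSpace.denseSeq (Space d)
  have hA : ∀ n, ∃ A : Set (Space d), IsOpen A ∧ Bornology.IsBounded A ∧ A ⊆ C ∧
      (q n ∈ C → q n ∈ A) ∧ perimeter A ≤ e n ∧ volume A ≤ e n := by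
    intro n
    by_cases hq : q n ∈ C
    · obtain ⟨δ, hδ, hδC⟩ := Metric.isOpen_iff.1 hC _ hq
      have h1 := eventually_ball_small hd (ε := e n) (by exact_mod_cast (he n).ne')
      have h2 : ∀ᶠ r : ℝ in 𝓝[>] 0, r ≤ δ := nhdsWithin_le_nhds (eventually_le_nhds hδ)
      obtain ⟨r, ⟨h3, h4⟩, h5⟩ := (h1.and h2).and self_mem_nhdsWithin |>.exists
      exact ⟨Metric.ball (q n) r, Metric.isOpen_ball, Metric.isBounded_ball,
        (Metric.ball_subset_ball h4).trans hδC, fun _ => Metric.mem_ball_self h5, h3 _⟩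
    · exact ⟨∅, isOpen_empty, Bornology.isBounded_empty, empty_subset _, fun h => absurd h hq,
        by simp [perimeter_empty], by simp⟩
  choose A hAo hAb hAC hAq hAp hAv using hA
  refine ⟨⋃ n, A n, isOpen_iUnion hAo, iUnion_subset hAC, ?_, ?_, ?_⟩
  · refine ((TopologicalSpace.denseRange_denseSeq (Space d)).open_subset_closure_inter
      hC).trans (closure_mono ?_)
    rintro _ ⟨h1, n, rfl⟩
    exact mem_iUnion.2 ⟨n, hAq n h1⟩
  · exact (perimeter_iUnion_nat_le (fun n => (hAo n).measurableSet) hAb).trans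
      ((ENNReal.tsum_le_tsum hAp).trans hesum.le)
  · exact (measure_iUnion_le _).trans ((ENNReal.tsum_le_tsum hAv).trans hesum.le)

/-- The homeomorphisms `Ψ` move every non-interior point off `Ω`, so `Ω \ interior Ω` lies in the
symmetric difference of `Ω` and its preimage, which is arbitrarily small. -/
theorem HasSmoothBoundary.volume_frontier {Ω : Set (Space d)} (hΩ : HasSmoothBoundary Ω)
    (hc : IsCompact Ω) : volume (Ω \ interior Ω) = 0 := by
  refine le_antisymm (le_of_forall_pos_le_add fun η hη => ?_) zero_le
  rw [zero_add]
  obtain ⟨θ₀, hθ₀, h⟩ := exists_volume_symmDiff_preimage_le hc.measurableSet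
    hc.measure_lt_top.ne 2 hη.ne'
  let θ : ℝ≥0 := min θ₀ (1 / 2)
  have hθ0 : 0 < θ := lt_min hθ₀ (by norm_num)
  have hθ2 : θ ≤ 1 / 2 := min_le_right _ _
  have hθ1 : θ < 1 := hθ2.trans_lt (by
    rw [← NNReal.coe_lt_coe]; norm_num)
  obtain ⟨Ψ, -, -, hΨanti, hΨd, hΨΩ⟩ := hΩ.exists_homeomorph hc hθ0 hθ1
  refine le_trans (measure_mono ?_) (h Ψ Ψ.continuous (fun x y => (hΨanti x y).trans ?_)
    fun x => (hΨd x).trans ?_)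
  · rintro x ⟨h1, h2⟩
    exact Or.inr ⟨h1, hΨΩ x h2⟩
  · have h2 : (1 - θ)⁻¹ ≤ 2 := by
      rw [inv_le_comm₀ (tsub_pos_of_lt hθ1) two_pos, ← NNReal.coe_le_coe, NNReal.coe_sub hθ1.le]
      have : (θ : ℝ) ≤ 1 / 2 := by exact_mod_cast hθ2
      push_cast
      linarith
    gcongr
  · have : θ ≤ θ₀ := min_le_left _ _
    exact_mod_cast this

/-- Spheres are null sets, including the degenerate one of radius zero. This feeds the intermediate
value argument that fixes the volume. -/
theorem continuous_volume_diff_closedBall (hd : 1 ≤ d) {S : Set (Space d)}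
    (hfin : volume S ≠ ⊤) (x : Space d) :
    Continuous fun ρ : ℝ => volume (S \ Metric.closedBall x ρ) := by
  have := nontrivial_space (d := d) (by omega)
  have hfm : IsFiniteMeasure (volume.restrict S) :=
    ⟨by rw [Measure.restrict_apply_univ]; exact hfin.lt_top⟩
  have heq : ∀ ρ : ℝ, volume (S \ Metric.closedBall x ρ)
      = volume.restrict S (Metric.closedBall x ρ)ᶜ := fun ρ => by
    rw [Measure.restrict_apply measurableSet_closedBall.compl, inter_comm]
    rfl
  simp only [heq]
  refine continuous_iff_continuousAt.2 fun ρ₀ => ?_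
  refine tendsto_measure_of_ae_tendsto_indicator_of_isFiniteMeasure (𝓝 ρ₀)
    measurableSet_closedBall.compl (fun ρ => measurableSet_closedBall.compl) ?_
  have hs : ∀ᵐ z ∂(volume.restrict S), z ∉ Metric.sphere x ρ₀ :=
    ae_restrict_of_ae (measure_eq_zero_iff_ae_notMem.1 (Measure.addHaar_sphere volume x ρ₀))
  filter_upwards [hs] with z hz
  rcases lt_or_gt_of_ne (fun h => hz h : dist z x ≠ ρ₀) with h | h
  · filter_upwards [lt_mem_nhds h] with ρ hρ
    simp [h.le, hρ.le]
  · filter_upwards [gt_mem_nhds h] with ρ hρ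
    simp [h, hρ]

/-- Sets of finite perimeter in `Ω` may be replaced by open sets of the same volume which are
prescribed on a small closed set, with a small change of the perimeter. -/
theorem HasSmoothBoundary.exists_competitor (hd : 2 ≤ d) {Ω : Set (Space d)}
    (hΩ : HasSmoothBoundary Ω) (hc : IsCompact Ω) {m : ℝ≥0∞} (hm : m ≠ 0) (hmΩ : m < volume Ω)
    {E : Set (Space d)} (hE : MeasurableSet E) (hEΩ : E ⊆ Ω) (hEm : volume E = m)
    (hP : perimeter E ≠ ⊤) {ε : ℝ≥0∞} (hε : ε ≠ 0) :
    ∃ η : ℝ≥0∞, η ≠ 0 ∧ ∀ C D : Set (Space d), IsClosed C → IsOpen D → D ⊆ C → C ⊆ Ω →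
      volume C ≤ η → perimeter C ≤ η → perimeter D ≤ η →
      ∃ F, IsOpen F ∧ F ⊆ Ω ∧ volume F = m ∧ D ⊆ F ∧ F ∩ C ⊆ D ∧
        perimeter F ≤ perimeter E + ε := by
  have hmt : m ≠ ⊤ := hmΩ.ne_top
  let ε' := ε / 5
  have hε' : ε' ≠ 0 := ENNReal.div_ne_zero.2 ⟨hε, ENNReal.ofNat_ne_top⟩
  -- Every ball around `x` contains a positive volume of `E` to remove, and every ball around `y` a
  -- positive volume of `interior Ω \ E` to add.
  obtain ⟨x, hxE, hx⟩ := exists_mem_forall_mem_nhdsWithin_pos_measure (μ := volume) (s := E)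
    (by rw [hEm]; exact hm)
  obtain ⟨y, ⟨hyΩ, -⟩, hy⟩ := exists_mem_forall_mem_nhdsWithin_pos_measure (μ := volume)
    (s := interior Ω \ E) (by
      intro h0
      refine absurd hmΩ (not_lt.2 ?_)
      calc volume Ω ≤ volume (E ∪ ((interior Ω \ E) ∪ (Ω \ interior Ω))) := by
            refine measure_mono fun z hz => ?_
            by_cases h1 : z ∈ E
            · exact Or.inl h1
            · by_cases h2 : z ∈ interior Ω
              · exact Or.inr (Or.inl ⟨h2, h1⟩)
              · exact Or.inr (Or.inr ⟨hz, h2⟩)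
        _ ≤ volume E + (volume (interior Ω \ E) + volume (Ω \ interior Ω)) :=
            (measure_union_le _ _).trans (by gcongr; exact measure_union_le _ _)
        _ = m := by rw [h0, hΩ.volume_frontier hc, hEm, add_zero, add_zero])
  obtain ⟨R₀, hR₀, hR₀P⟩ := mem_nhdsGT_iff_exists_Ioo_subset.1 (eventually_ball_small hd hε')
  let R := R₀ / 2
  have hR : 0 < R := half_pos hR₀
  let v := volume (E ∩ Metric.ball x R)
  have hv : v ≠ 0 :=
    (hx _ (inter_mem_nhdsWithin E (Metric.ball_mem_nhds x hR))).ne'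
  have hvt : v ≠ ⊤ := ((measure_mono inter_subset_left).trans_lt (hEm ▸ hmt.lt_top)).ne
  have hv2 : v / 2 ≠ 0 := (ENNReal.half_pos hv).ne'
  obtain ⟨s₀, hs₀, hs₀Ω⟩ := Metric.isOpen_iff.1 isOpen_interior y hyΩ
  obtain ⟨s, ⟨⟨hs1, hs2⟩, hs3⟩, hs0⟩ := (((eventually_ball_small hd hε').and
    (eventually_ball_small hd hv2)).and (nhdsWithin_le_nhds (eventually_le_nhds hs₀))).and
      self_mem_nhdsWithin |>.exists
  have hs0 : 0 < s := hs0
  have hBΩ : Metric.ball y s ⊆ Ω :=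
    ((Metric.ball_subset_ball hs3).trans hs₀Ω).trans interior_subset
  let w := volume (Metric.ball y s \ E)
  have hw : w ≠ 0 := by
    refine ((hy _ (inter_mem_nhdsWithin _ (Metric.ball_mem_nhds y hs0))).trans_le
      (measure_mono ?_)).ne'
    rintro z ⟨⟨-, h1⟩, h2⟩
    exact ⟨h2, h1⟩
  have hwt : w ≠ ⊤ := ((measure_mono sdiff_subset).trans_lt measure_ball_lt_top).ne
  -- The errors from `A` and `C` are at most `2 * η` in volume: below the supply `w` near `y`, and
  -- below the half of `v` that the ball around `y`, of volume at most `v / 2`, leaves over.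
  let η := min ε' (min (v / 4) (w / 2))
  have hη : η ≠ 0 := by
    refine (lt_min (pos_iff_ne_zero.2 hε') (lt_min ?_ ?_)).ne'
    · exact ENNReal.div_pos hv ENNReal.ofNat_ne_top
    · exact ENNReal.half_pos hw
  have hηε : η ≤ ε' := min_le_left _ _
  have hηv : η + η ≤ v / 2 := by
    have h1 : η ≤ v / 4 := (min_le_right _ _).trans (min_le_left _ _)
    calc η + η ≤ v / 4 + v / 4 := add_le_add h1 h1
      _ = v / 2 := by
        rw [← two_mul, ← mul_div_assoc, show (4 : ℝ≥0∞) = 2 * 2 by norm_num]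
        exact ENNReal.mul_div_mul_left _ _ two_ne_zero ENNReal.ofNat_ne_top
  have hηw : η + η ≤ w := by
    have h1 : η ≤ w / 2 := (min_le_right _ _).trans (min_le_right _ _)
    exact (add_le_add h1 h1).trans (ENNReal.add_halves w).le
  obtain ⟨A, hAo, hAΩ, hAP, hAE⟩ := hΩ.exists_open_approx hc hE hEΩ hP hη
  refine ⟨η, hη, fun C D hC hD hDC hCΩ hCv hCP hDP => ?_⟩
  let G := A ∪ Metric.ball y s
  have hGo : IsOpen G := hAo.union Metric.isOpen_ball
  have hGΩ : G ⊆ Ω := union_subset hAΩ hBΩ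
  -- The radius `ρ` of the hole around `x` is the free parameter that adjusts the volume.
  let H : ℝ → Set (Space d) := fun ρ => (G \ C) \ Metric.closedBall x ρ
  have hHo : ∀ ρ, IsOpen (H ρ) := fun ρ => (hGo.sdiff hC).sdiff Metric.isClosed_closedBall
  have hHD : ∀ ρ, Disjoint (H ρ) D := fun ρ =>
    Set.disjoint_left.2 fun z hz hzD => hz.1.2 (hDC hzD)
  let F : ℝ → Set (Space d) := fun ρ => H ρ ∪ D
  have hFvol : ∀ ρ, volume (F ρ) = volume (H ρ) + volume D := fun ρ =>
    measure_union (hHD ρ) hD.measurableSet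
  have hΩb : Bornology.IsBounded Ω := hc.isBounded
  have hcont : Continuous fun ρ => volume (F ρ) := by
    simp only [hFvol]
    refine (continuous_volume_diff_closedBall (by omega) ?_ x).add continuous_const
    exact ((measure_mono (sdiff_subset.trans hGΩ)).trans_lt hc.measure_lt_top).ne
  -- At `ρ = 0` the hole is a null set, and the volume `w` gained near `y` outweighs the losses.
  have hlow : m ≤ volume (F 0) := by
    have h1 : m + w ≤ volume (F 0) + (η + η) := by
      calc m + w = volume (E ∪ (Metric.ball y s \ E)) := by
            rw [measure_union disjoint_sdiff_right (measurableSet_ball.diff hE), hEm]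
        _ ≤ volume (F 0 ∪ ({x} ∪ (C ∪ symmDiff A E))) := by
            refine measure_mono fun z hz => ?_
            by_cases hzC : z ∈ C
            · exact Or.inr (Or.inr (Or.inl hzC))
            by_cases hzx : z = x
            · exact Or.inr (Or.inl hzx)
            by_cases hzG : z ∈ G
            · refine Or.inl (Or.inl ⟨⟨hzG, hzC⟩, ?_⟩)
              simpa using hzx
            · rcases hz with hz | hz
              · exact Or.inr (Or.inr (Or.inr (Or.inr ⟨hz, fun h => hzG (Or.inl h)⟩)))
              · exact absurd (Or.inr hz.1) hzG
        _ ≤ volume (F 0) + (volume {x} + (volume C + volume (symmDiff A E))) :=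
            (measure_union_le _ _).trans (add_le_add le_rfl ((measure_union_le _ _).trans
              (add_le_add le_rfl (measure_union_le _ _))))
        _ ≤ volume (F 0) + (η + η) := by
            have := nontrivial_space (d := d) (by omega)
            rw [measure_singleton, zero_add]
            gcongr
    exact (ENNReal.add_le_add_iff_right hwt).1 (h1.trans (by gcongr))
  -- At `ρ = R` the hole removes at least `v` from `E`, which outweighs all gains.
  have hupp : volume (F R) ≤ m := by
    have h1 : volume (E \ Metric.ball x R) + v = m := by
      rw [← hEm, add_comm]
      exact measure_inter_add_sdiff E measurableSet_ball
    have h2 : volume (F R) ≤ volume (E \ Metric.ball x R) + (v / 2 + (η + η)) := by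
      calc volume (F R)
          ≤ volume ((E \ Metric.ball x R) ∪ (Metric.ball y s ∪ (symmDiff A E ∪ C))) := by
            refine measure_mono ?_
            rintro z (⟨⟨hzG, -⟩, hzx⟩ | hzD)
            · rcases hzG with hzA | hzB
              · by_cases hzE : z ∈ E
                · exact Or.inl ⟨hzE, fun h => hzx (Metric.ball_subset_closedBall h)⟩
                · exact Or.inr (Or.inr (Or.inl (Or.inl ⟨hzA, hzE⟩)))
              · exact Or.inr (Or.inl hzB)
            · exact Or.inr (Or.inr (Or.inr (hDC hzD)))
        _ ≤ volume (E \ Metric.ball x R)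
              + (volume (Metric.ball y s) + (volume (symmDiff A E) + volume C)) :=
            (measure_union_le _ _).trans (add_le_add le_rfl ((measure_union_le _ _).trans
              (add_le_add le_rfl (measure_union_le _ _))))
        _ ≤ _ := by
            gcongr
            exact (hs2 y).2
    refine h2.trans ?_
    rw [← h1]
    gcongr
    calc v / 2 + (η + η) ≤ v / 2 + v / 2 := by gcongr
      _ = v := ENNReal.add_halves v
  obtain ⟨ρ, ⟨hρ0, hρR⟩, hρ⟩ := intermediate_value_Icc' hR.le hcont.continuousOn
    (show m ∈ Icc (volume (F R)) (volume (F 0)) from ⟨hupp, hlow⟩)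
  have hFΩ : F ρ ⊆ Ω := union_subset ((sdiff_subset.trans sdiff_subset).trans hGΩ) (hDC.trans hCΩ)
  refine ⟨F ρ, (hHo ρ).union hD, hFΩ, hρ, subset_union_right, ?_, ?_⟩
  · rintro z ⟨hz | hz, hzC⟩
    · exact absurd hzC hz.1.2
    · exact hz
  · have hBρ : perimeter (Metric.closedBall x ρ) ≤ ε' := by
      rcases hρ0.eq_or_lt with h | h
      · have := nontrivial_space (d := d) (by omega)
        rw [← h, Metric.closedBall_zero,
          perimeter_congr (ae_eq_empty.2 (measure_singleton x)), perimeter_empty]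
        exact zero_le
      · rw [perimeter_congr (closedBall_ae_eq_ball x h.ne')]
        exact (hR₀P ⟨h, hρR.trans_lt (half_lt_self hR₀)⟩ x).1
    have hCb := hΩb.subset hCΩ
    have hGb := hΩb.subset hGΩ
    calc perimeter (F ρ) ≤ perimeter (H ρ) + perimeter D :=
          perimeter_union_le (hHo ρ).measurableSet hD.measurableSet
            (hGb.subset (sdiff_subset.trans sdiff_subset)) (hCb.subset hDC)
      _ ≤ (perimeter (G \ C) + perimeter (Metric.closedBall x ρ)) + perimeter D := by
          gcongr
          exact perimeter_diff_le (hGo.sdiff hC).measurableSet measurableSet_closedBall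
            (hGb.subset sdiff_subset) Metric.isBounded_closedBall
      _ ≤ (((perimeter A + perimeter (Metric.ball y s)) + perimeter C)
            + perimeter (Metric.closedBall x ρ)) + perimeter D := by
          gcongr
          refine (perimeter_diff_le hGo.measurableSet hC.measurableSet hGb hCb).trans ?_
          gcongr
          exact perimeter_union_le hAo.measurableSet measurableSet_ball (hΩb.subset hAΩ)
            Metric.isBounded_ball
      _ ≤ ((((perimeter E + ε') + ε') + ε') + ε') + ε' := by
          gcongr
          · exact hAP.trans (by gcongr)
          · exact (hs1 y).1
          · exact hCP.trans hηε
          · exact hDP.trans hηε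
      _ = perimeter E + 5 * ε' := by ring
      _ = perimeter E + ε := by
          rw [ENNReal.mul_div_cancel (by norm_num) ENNReal.ofNat_ne_top]

/-! ### The upper and lower bounds for the two functionals. -/

/-- Passage to the limit in the upper bounds. -/
theorem iInf_openClass_le {Ω : Set (Space d)} {m : ℝ} {P I q : ℝ≥0∞} (hI : I ≠ ⊤) (hq : q ≠ ⊤)
    {J : Set (Space d) → ℝ≥0∞}
    (h : ∀ ε : ℝ≥0∞, 0 < ε → ε < 1 → ∃ F ∈ openClass Ω m,
      perimeter F ≤ P + ε ∧ J F ≤ ((1 - ε)⁻¹) ^ 2 * (I + ε)) :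
    ⨅ F ∈ openClass Ω m, (perimeter F + q * J F) ≤ P + q * I := by
  have h1 : Tendsto (fun ε : ℝ≥0∞ => (1 - ε)⁻¹) (𝓝 0) (𝓝 1) := by
    have : Tendsto (fun ε : ℝ≥0∞ => 1 - ε) (𝓝 0) (𝓝 (1 - 0)) :=
      ENNReal.Tendsto.sub tendsto_const_nhds tendsto_id (Or.inl ENNReal.one_ne_top)
    rw [tsub_zero] at this
    simpa using this.inv
  have h2 : Tendsto (fun ε : ℝ≥0∞ => ((1 - ε)⁻¹) ^ 2 * (I + ε)) (𝓝 0) (𝓝 (1 ^ 2 * (I + 0))) :=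
    ENNReal.Tendsto.mul (ENNReal.Tendsto.pow h1) (Or.inr (by simpa using hI))
      (tendsto_const_nhds.add tendsto_id) (Or.inr (by simp))
  rw [one_pow, one_mul, add_zero] at h2
  have h3 : Tendsto (fun ε : ℝ≥0∞ => (P + ε) + q * (((1 - ε)⁻¹) ^ 2 * (I + ε))) (𝓝 0)
      (𝓝 ((P + 0) + q * I)) :=
    (tendsto_const_nhds.add tendsto_id).add (ENNReal.Tendsto.const_mul h2 (Or.inr hq))
  rw [add_zero] at h3
  refine ge_of_tendsto (h3.mono_left (nhdsWithin_le_nhds (s := Ioi 0))) ?_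
  filter_upwards [self_mem_nhdsWithin, nhdsWithin_le_nhds (gt_mem_nhds one_pos)] with ε h4 h5
  obtain ⟨F, hF, hF1, hF2⟩ := h ε h4 h5
  exact (iInf₂_le F hF).trans (by gcongr)

/-- Both bounds glue charged balls `C` to a competitor near `E₀`: for `F` all of `C`, so the charge
lies in the competitor; for `G` only a dense open `D ⊆ C`, so that `C \ D` falls in the boundary. -/
theorem IsIsoperimetricSolution.iInf_functionalF_functionalG_le (hd : 2 ≤ d) {Ω : Set (Space d)}
    (hΩ : IsCompact Ω) (hΩs : HasSmoothBoundary Ω) {m : ℝ} (hm : 0 < m)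
    (hmΩ : ENNReal.ofReal m < volume Ω) {E₀ : Set (Space d)}
    (hE₀ : IsIsoperimetricSolution Ω m E₀) {α : ℝ} (hα : 0 < α) (hαd : α < (d : ℝ) - 1) (Q : ℝ)
    (hP : perimeter E₀ ≠ ⊤) (hI : rieszEnergy α Ω ≠ ⊤) :
    ⨅ E ∈ openClass Ω m, functionalF α Q E
        ≤ perimeter E₀ + ENNReal.ofReal (Q ^ 2) * rieszEnergy α Ω ∧
    ⨅ E ∈ openClass Ω m, functionalG α Q E
        ≤ perimeter E₀ + ENNReal.ofReal (Q ^ 2) * rieszEnergy α Ω := by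
  obtain ⟨⟨hnull, hE₀Ω, hE₀m⟩, -⟩ := hE₀
  obtain ⟨t, hE₀t, htm, htae⟩ := hnull.exists_measurable_superset_ae_eq
  -- A genuinely measurable representative of `E₀`, still contained in `Ω`.
  let E := t ∩ Ω
  have hEae : E =ᵐ[volume] E₀ := by
    have h1 : E =ᵐ[volume] (E₀ ∩ Ω : Set (Space d)) := htae.inter (ae_eq_refl Ω)
    rwa [inter_eq_self_of_subset_left hE₀Ω] at h1
  have hEP : perimeter E = perimeter E₀ := perimeter_congr hEae
  have hEm : volume E = ENNReal.ofReal m := (measure_congr hEae).trans hE₀m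
  have hcomp := fun (ε : ℝ≥0∞) (hε : ε ≠ 0) => hΩs.exists_competitor hd hΩ
    (ENNReal.ofReal_pos.2 hm).ne' hmΩ (htm.inter hΩ.measurableSet) inter_subset_right hEm
    (hEP ▸ hP) hε
  refine ⟨iInf_openClass_le hI ENNReal.ofReal_ne_top fun ε hε0 hε1 => ?_,
    iInf_openClass_le (J := fun F => rieszEnergy α (frontier F)) hI ENNReal.ofReal_ne_top
      fun ε hε0 hε1 => ?_⟩
  all_goals
    obtain ⟨η, hη, hηC⟩ := hcomp ε hε0.ne'
    have hζ0 : min η ε ≠ 0 := (lt_min (pos_iff_ne_zero.2 hη) hε0).ne'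
    have hζt : min η ε ≠ ⊤ := ((min_le_right _ _).trans_lt (hε1.trans ENNReal.one_lt_top)).ne
    obtain ⟨C, C', ν, c, hCo, hC', hCC', hC'Ω, hC'v, hCP, hC'P, hν, hνC, hct, hνc, hνI⟩ :=
      hΩs.exists_charged_balls hd hΩ hα hαd hI hζ0 hζt
    have hνI' : rieszInteraction α ν ν ≤ rieszEnergy α Ω + ε :=
      hνI.trans (by gcongr; exact min_le_right _ _)
    have hε1' : 1 - ε ≠ 0 := (tsub_pos_of_lt hε1).ne'
  · obtain ⟨F, hFo, hFΩ, hFm, hCF, -, hFP⟩ := hηC C' C hC' hCo hCC' hC'Ω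
      (hC'v.trans (min_le_left _ _)) (hC'P.trans (min_le_left _ _)) (hCP.trans (min_le_left _ _))
    refine ⟨F, ⟨hFo, hFΩ, hFm⟩, hEP ▸ hFP, ?_⟩
    refine (rieszEnergy_le_of_le_measure (ν := ν) hε1' ?_).trans (by gcongr)
    exact tsub_le_self.trans (hνC ▸ measure_mono hCF)
  -- The density of `ν` is at most `c`, so volume at most `ε / c` carries charge at most `ε`.
  · have hδ0 : min η (ε / c) ≠ 0 :=
      (lt_min (pos_iff_ne_zero.2 hη) (ENNReal.div_pos hε0.ne' hct)).ne'
    obtain ⟨D, hDo, hDC, hCD, hDP, hDv⟩ := exists_dense_open_small hd hCo hδ0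
    obtain ⟨F, hFo, hFΩ, hFm, hDF, hFC, hFP⟩ := hηC C' D hC' hDo (hDC.trans hCC') hC'Ω
      (hC'v.trans (min_le_left _ _)) (hC'P.trans (min_le_left _ _)) (hDP.trans (min_le_left _ _))
    refine ⟨F, ⟨hFo, hFΩ, hFm⟩, hEP ▸ hFP, ?_⟩
    refine (rieszEnergy_le_of_le_measure (ν := ν) hε1' ?_).trans (by gcongr)
    -- `D` is dense in `C`, so the closure of `F` contains `C`, while `F` itself meets `C'` only
    -- inside `D`.
    have hsub : C \ D ⊆ frontier F := by
      rintro z ⟨hzC, hzD⟩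
      rw [hFo.frontier_eq]
      exact ⟨closure_mono hDF (hCD hzC), fun hzF => hzD (hFC ⟨hzF, hCC' hzC⟩)⟩
    have hνD : ν D ≤ ε := by
      refine (hνc D).trans ((mul_le_mul_right (hDv.trans (min_le_right _ _)) c).trans ?_)
      exact ENNReal.mul_div_le
    calc 1 - ε ≤ ν C - ν D := by rw [hνC]; exact tsub_le_tsub_left hνD 1
      _ ≤ ν (C \ D) := le_measure_sdiff
      _ ≤ ν (frontier F) := measure_mono hsub

theorem IsIsoperimetricSolution.le_iInf_functionalF {Ω : Set (Space d)} {m : ℝ}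
    {E₀ : Set (Space d)} (hE₀ : IsIsoperimetricSolution Ω m E₀) (α Q : ℝ) :
    perimeter E₀ + ENNReal.ofReal (Q ^ 2) * rieszEnergy α Ω
      ≤ ⨅ E ∈ openClass Ω m, functionalF α Q E := by
  refine le_iInf₂ fun E ⟨hEo, hEΩ, hEm⟩ => ?_
  unfold functionalF
  gcongr
  · exact hE₀.2 E ⟨hEo.measurableSet.nullMeasurableSet, hEΩ, hEm⟩
  · exact rieszEnergy_mono hEo.measurableSet hEΩ

theorem IsIsoperimetricSolution.le_iInf_functionalG {Ω : Set (Space d)} (hΩ : IsClosed Ω) {m : ℝ}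
    {E₀ : Set (Space d)} (hE₀ : IsIsoperimetricSolution Ω m E₀) (α Q : ℝ) :
    perimeter E₀ + ENNReal.ofReal (Q ^ 2) * rieszEnergy α Ω
      ≤ ⨅ E ∈ openClass Ω m, functionalG α Q E := by
  refine le_iInf₂ fun E ⟨hEo, hEΩ, hEm⟩ => ?_
  unfold functionalG
  gcongr
  · exact hE₀.2 E ⟨hEo.measurableSet.nullMeasurableSet, hEΩ, hEm⟩
  · exact rieszEnergy_mono isClosed_frontier.measurableSet
      (frontier_subset_closure.trans (closure_minimal hEΩ hΩ))

end ChargedDroplet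

theorem mainTheorem2 {d : ℕ} (hd : 2 ≤ d) (Ω : Set (ChargedDroplet.Space d))
    (hΩ : IsCompact Ω) (hΩs : ChargedDroplet.HasSmoothBoundary Ω)
    (m : ℝ) (hm : 0 < m) (hmΩ : ENNReal.ofReal m < volume Ω)
    (E₀ : Set (ChargedDroplet.Space d))
    (hE₀ : ChargedDroplet.IsIsoperimetricSolution Ω m E₀)
    (α : ℝ) (hα : 0 < α) (hαd : α < (d : ℝ) - 1) (Q : ℝ) (hQ : 0 < Q) :
    (⨅ E ∈ ChargedDroplet.openClass Ω m, ChargedDroplet.functionalF α Q E)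
        = ChargedDroplet.perimeter E₀
          + ENNReal.ofReal (Q ^ 2) * ChargedDroplet.rieszEnergy α Ω ∧
    (⨅ E ∈ ChargedDroplet.openClass Ω m, ChargedDroplet.functionalG α Q E)
        = ChargedDroplet.perimeter E₀
          + ENNReal.ofReal (Q ^ 2) * ChargedDroplet.rieszEnergy α Ω := by
  have hF := hE₀.le_iInf_functionalF α Q
  have hG := hE₀.le_iInf_functionalG hΩ.isClosed α Q
  by_cases hfin : ChargedDroplet.perimeter E₀ ≠ ⊤ ∧ ChargedDroplet.rieszEnergy α Ω ≠ ⊤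
  · obtain ⟨hF', hG'⟩ := hE₀.iInf_functionalF_functionalG_le hd hΩ hΩs hm hmΩ hα hαd Q
      hfin.1 hfin.2
    exact ⟨le_antisymm hF' hF, le_antisymm hG' hG⟩
  -- If the right-hand side is infinite, the lower bounds suffice; `Q ≠ 0` rules out the convention
  -- `0 * ⊤ = 0`.
  · have htop : ChargedDroplet.perimeter E₀
        + ENNReal.ofReal (Q ^ 2) * ChargedDroplet.rieszEnergy α Ω = ⊤ := by
      have hQ2 : ENNReal.ofReal (Q ^ 2) ≠ 0 := (ENNReal.ofReal_pos.2 (by positivity)).ne'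
      rw [not_and_or, not_not, not_not] at hfin
      rcases hfin with h | h
      · rw [h, top_add]
      · rw [h, ENNReal.mul_top hQ2, add_top]
    rw [htop] at hF hG ⊢
    exact ⟨top_le_iff.1 hF, top_le_iff.1 hG⟩
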